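/- Let $m$ be finite, $m>2$. All algebras below are Boolean algebras with unary operations $\mathsf c_i$ and constants $\mathsf d_{ij}$ ($i,j<m$); $\mathsf{CA}_m$ is the class of cylindric algebras of dimension $m$, and $\mathsf{RCA}_m=\mathbf{SP}\{\wp({}^mU): U \text{ a set}\}$, where $\wp({}^mU)$ is the full cylindric set algebra. The canonical extension $\mathfrak A^+$ is the complex algebra of the ultrafilter frame of $\mathfrak A$. For $\delta\in{}^mn$ write $\delta[i\to d]$ for the tuple obtained from $\delta$ by putting $d$ in the $i$-th place. Let $n\ge m$ be finite and let $\mathfrak B\in\mathsf{CA}_m$ be atomic. An $n$-dimensional network over $\mathfrak B$ is a map $N:{}^mn\to \mathrm{At}\,\mathfrak B$ such that for all $\delta\in{}^mn$, $i,j<m$, $d<n$: $N(\delta[i\to\delta_j])\le \mathsf d_{ij}$; $N(\delta[i\to d])\le\mathsf c_iN(\delta)$; and if $N(\delta)\le\mathsf d_{ij}$ then the nodes $\delta_i$ and $\delta_j$ are interchangeable, i.e. $N(\varepsilon[k\to\delta_j])=N(\varepsilon)$ whenever $\varepsilon\in{}^mn$ and $\varepsilon_k=\delta_i$. An $n$-dimensional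 basis of $\mathfrak B$ is a set $H$ of $n$-dimensional networks over $\mathfrak B$ such that (i) for every atom $a$ there is $N\in H$ with $N(0,1,\dots,m-1)=a$; (ii) if $N\in H$, $x\in{}^mn$, $i<m$, $a$ is an atom with $N(x)\le\mathsf c_ia$, and $k<n$ differs from $x_j$ for every $j\ne i$, then there is $N'\in H$ which agrees with $N$ on all tuples of nodes avoiding $k$ and satisfies $N'(x[i\to k])=a$. Let $\mathsf{CAB}_{m,n}$ be the class of all algebras isomorphic to a subalgebra of a complete atomic $\mathfrak B\in\mathsf{CA}_m$ that has an $n$-dimensional basis. A relativized representation of $\mathfrak A$ is a non-empty set $M$ with a set $V\subseteq{}^mM$ and an injective homomorphism $f:\mathfrak A\to\wp(V)$ (operations relativized to $V$), such that $M=\bigcup_{s\in V}\mathrm{rng}(s)$. A set $C\subseteq M$ is a clique if ${}^mC\subseteq V$; $C^n(M)$ is the set of $s\in{}^nM$ whose range is a clique. The representation is $n$-square if, whenever $s\in C^n(M)$, $a\in\mathfrak A$, $i<m$, $l:m\to n$ with $l(j)\neq l(i)$ for all $j\ne i$, and $(s_{l(0)},\dots,s_{l(m-1)})\in f(\mathsf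 c_ia)$, there is $t\in C^n(M)$ that agrees with $s$ except possibly at $l(i)$ and satisfies $(t_{l(0)},\dots,t_{l(m-1)})\in f(a)$. Then for all finite $m>2$ and $n\ge m$: 1. $\mathsf{CAB}_{m,n}$ is a canonical variety: it is closed under homomorphic images, subalgebras, direct products, and canonical extensions. 2. For $\mathfrak A\in\mathsf{CA}_m$: $\mathfrak A\in\mathsf{CAB}_{m,n}$ iff $\mathfrak A^+$ has an $n$-dimensional basis. 3. For $\mathfrak A\in\mathsf{CA}_m$ with more than one element: $\mathfrak A\in\mathsf{CAB}_{m,n}$ iff $\mathfrak A$ has an $n$-square relativized representation. 4. $\bigcap_{k\in\omega,\,k\ge m}\mathsf{CAB}_{m,k}=\mathsf{RCA}_m$. -/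

import Mathlib

universe u v

/-- An algebra of the similarity type of `m`-dimensional cylindric algebras: a Boolean algebra with
unary operations `c_i` and constants `d_ij` (no cylindric axiom is imposed here). -/
structure CylAlg (m : ℕ) : Type (u + 1) where
  carrier : Type u
  [ba : BooleanAlgebra carrier]
  cyl : Fin m → carrier → carrier
  diag : Fin m → Fin m → carrier

namespace CylAlg

instance (m : ℕ) : CoeSort (CylAlg.{u} m) (Type u) := ⟨CylAlg.carrier⟩

instance {m : ℕ} (A : CylAlg.{u} m) : BooleanAlgebra A := A.ba

/-- `A ∈ CA_m`: the axioms of cylindric algebras of dimension `m`. -/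
structure IsCA {m : ℕ} (A : CylAlg.{u} m) : Prop where
  cyl_bot : ∀ i, A.cyl i ⊥ = ⊥
  le_cyl : ∀ i (x : A), x ≤ A.cyl i x
  cyl_inf_cyl : ∀ i (x y : A), A.cyl i (x ⊓ A.cyl i y) = A.cyl i x ⊓ A.cyl i y
  cyl_comm : ∀ i j (x : A), A.cyl i (A.cyl j x) = A.cyl j (A.cyl i x)
  diag_self : ∀ i, A.diag i i = ⊤
  diag_eq : ∀ i j k, k ≠ i → k ≠ j → A.diag i j = A.cyl k (A.diag i k ⊓ A.diag k j)
  cyl_diag : ∀ i j (x : A), i ≠ j →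
    A.cyl i (A.diag i j ⊓ x) ⊓ A.cyl i (A.diag i j ⊓ xᶜ) = ⊥

/-- Homomorphisms of the cylindric similarity type. -/
structure IsHom {m : ℕ} {A : CylAlg.{u} m} {B : CylAlg.{v} m} (f : A → B) : Prop where
  map_bot : f ⊥ = ⊥
  map_top : f ⊤ = ⊤
  map_sup : ∀ x y : A, f (x ⊔ y) = f x ⊔ f y
  map_inf : ∀ x y : A, f (x ⊓ y) = f x ⊓ f y
  map_compl : ∀ x : A, f xᶜ = (f x)ᶜ
  map_cyl : ∀ i (x : A), f (A.cyl i x) = B.cyl i (f x)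
  map_diag : ∀ i j, f (A.diag i j) = B.diag i j

/-- `A` is isomorphic to a subalgebra of `B`. -/
def Embeds {m : ℕ} (A : CylAlg.{u} m) (B : CylAlg.{v} m) : Prop :=
  ∃ f : A → B, IsHom f ∧ Function.Injective f

/-- Direct products. -/
def prod {m : ℕ} {I : Type u} (A : I → CylAlg.{u} m) : CylAlg.{u} m where
  carrier := ∀ j, A j
  cyl i x := fun j => (A j).cyl i (x j)
  diag i k := fun j => (A j).diag i k

/-- A variety: a class of algebras closed under homomorphic images, (isomorphic copies of)
subalgebras and direct products. -/
structure IsVariety {m : ℕ} (K : Set (CylAlg.{u} m)) : Prop where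
  homImage : ∀ A ∈ K, ∀ (B : CylAlg.{u} m) (f : A → B),
    IsHom f → Function.Surjective f → B ∈ K
  sub : ∀ A ∈ K, ∀ B : CylAlg.{u} m, Embeds B A → B ∈ K
  prod : ∀ (I : Type u) (A : I → CylAlg.{u} m), (∀ j, A j ∈ K) → CylAlg.prod A ∈ K

/-- The Boolean ultrafilters of `A`. -/
structure Uf {m : ℕ} (A : CylAlg.{u} m) : Type u where
  sets : Set A
  top_mem : ⊤ ∈ sets
  bot_notMem : ⊥ ∉ sets
  up_closed : ∀ {x y : A}, x ∈ sets → x ≤ y → y ∈ sets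
  inf_mem : ∀ {x y : A}, x ∈ sets → y ∈ sets → x ⊓ y ∈ sets
  mem_or_compl_mem : ∀ x : A, x ∈ sets ∨ xᶜ ∈ sets

/-- The canonical extension `A⁺`: the complex algebra of the ultrafilter frame of `A`. -/
def canExt {m : ℕ} (A : CylAlg.{u} m) : CylAlg.{u} m where
  carrier := Set (Uf A)
  cyl i X := {μ | ∃ ν ∈ X, ∀ a ∈ ν.sets, A.cyl i a ∈ μ.sets}
  diag i j := {μ | A.diag i j ∈ μ.sets}

/-- A canonical variety: a variety closed under canonical extensions. -/
def IsCanonicalVariety {m : ℕ} (K : Set (CylAlg.{u} m)) : Prop :=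
  IsVariety K ∧ ∀ A ∈ K, A.canExt ∈ K

/-- The set algebra `℘(V)` with unit `V ⊆ ᵐM`, cylindrifications being relativized to `V`. -/
def relSetAlg {m : ℕ} {M : Type u} (V : Set (Fin m → M)) : CylAlg.{u} m where
  carrier := Set V
  cyl i X := {s | ∃ t ∈ X, ∀ j, j ≠ i → t.1 j = s.1 j}
  diag i j := {s | s.1 i = s.1 j}

/-- The full set algebra `℘(ᵐU)`. -/
def fullSetAlg (m : ℕ) (U : Type u) : CylAlg.{u} m where
  carrier := Set (Fin m → U)
  cyl i X := {s | ∃ t ∈ X, ∀ j, j ≠ i → t j = s j}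
  diag i j := {s | s i = s j}

/-- `RCA_m = SP {℘(ᵐU) : U a set}`. -/
def RCA (m : ℕ) : Set (CylAlg.{u} m) :=
  {A | ∃ (I : Type u) (U : I → Type u), Embeds A (prod fun j => fullSetAlg m (U j))}

/-- Completeness: every set of elements has a supremum. -/
def IsCompleteAlg {m : ℕ} (A : CylAlg.{u} m) : Prop :=
  ∀ S : Set A, ∃ x, IsLUB S x

/-- `N : ᵐn → At A` is an (atomic) network over `A` whose nodes are the elements of `Fin n`. -/
structure IsNetwork {m : ℕ} (A : CylAlg.{u} m) (n : ℕ) (N : (Fin m → Fin n) → A) : Prop where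
  atom : ∀ δ, IsAtom (N δ)
  diag : ∀ δ i j, N (Function.update δ i (δ j)) ≤ A.diag i j
  cyl : ∀ δ i (d : Fin n), N (Function.update δ i d) ≤ A.cyl i (N δ)
  /-- Nodes that `N` labels as equal are interchangeable in all labels. -/
  congr : ∀ δ i j, N δ ≤ A.diag i j →
    ∀ ε k, ε k = δ i → N (Function.update ε k (δ j)) = N ε

/-- `H` is an `n`-dimensional basis of `A`. (The hypothesis `m ≤ n` lets `(0, …, m - 1)` be read as
a tuple of nodes.) -/
structure IsBasis {m : ℕ} (A : CylAlg.{u} m) {n : ℕ} (hmn : m ≤ n)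
    (H : Set ((Fin m → Fin n) → A)) : Prop where
  network : ∀ N ∈ H, IsNetwork A n N
  atom : ∀ a : A, IsAtom a → ∃ N ∈ H, N (Fin.castLE hmn) = a
  /-- If `N(x) ≤ c_i a` and the node `k` is not among the `x_j` with `j ≠ i`, then some network of
  the basis agrees with `N` off `k` and labels `x[i → k]` by `a`. -/
  witness : ∀ N ∈ H, ∀ (x : Fin m → Fin n) (i : Fin m) (a : A), IsAtom a → N x ≤ A.cyl i a →
    ∀ k : Fin n, (∀ j, j ≠ i → x j ≠ k) →
      ∃ N' ∈ H, (∀ y : Fin m → Fin n, (∀ j, y j ≠ k) → N' y = N y) ∧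
        N' (Function.update x i k) = a

/-- `A` has an `n`-dimensional basis. -/
def HasBasis {m : ℕ} (A : CylAlg.{u} m) {n : ℕ} (hmn : m ≤ n) : Prop :=
  ∃ H : Set ((Fin m → Fin n) → A), IsBasis A hmn H

/-- The class `CAB_{m,n}`: (isomorphic copies of) subalgebras of complete atomic cylindric algebras
of dimension `m` that have an `n`-dimensional basis. -/
def CAB {m n : ℕ} (hmn : m ≤ n) : Set (CylAlg.{u} m) :=
  {A | ∃ B : CylAlg.{u} m, B.IsCA ∧ B.IsCompleteAlg ∧ IsAtomic B ∧ B.HasBasis hmn ∧ Embeds A B}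

/-- A relativized representation of `A` with base `M`. -/
structure RelRep {m : ℕ} (A : CylAlg.{u} m) (M : Type u) where
  nonempty : Nonempty M
  V : Set (Fin m → M)
  f : A → relSetAlg V
  isHom : IsHom f
  injective : Function.Injective f
  cover : ∀ p : M, ∃ s ∈ V, p ∈ Set.range s

namespace RelRep

/-- `M ⊨ a(s)`. -/
def Sat {m : ℕ} {A : CylAlg.{u} m} {M : Type u} (R : RelRep A M) (a : A) (s : Fin m → M) : Prop :=
  ∃ h : s ∈ R.V, (⟨s, h⟩ : R.V) ∈ (show Set R.V from R.f a)

/-- `C` is an (`m`-)clique: every `m`-tuple of elements of `C` belongs to `V`. -/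
def IsClique {m : ℕ} {A : CylAlg.{u} m} {M : Type u} (R : RelRep A M) (C : Set M) : Prop :=
  ∀ s : Fin m → M, (∀ j, s j ∈ C) → s ∈ R.V

/-- `C^n(M)`: the `n`-tuples whose range is a clique. -/
def cliqueTuples {m : ℕ} {A : CylAlg.{u} m} {M : Type u} (R : RelRep A M) (n : ℕ) :
    Set (Fin n → M) :=
  {s | R.IsClique (Set.range s)}

/-- The representation is `n`-square: if `s ∈ C^n(M)` and `M ⊨ c_i a (s_{l(0)}, …, s_{l(m-1)})`,
where the variable `l(i)` occurs only in the `i`-th place, then changing `s` at the variable `l(i)`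
only yields some `t ∈ C^n(M)` with `M ⊨ a (t_{l(0)}, …, t_{l(m-1)})`. -/
def IsSquare {m : ℕ} {A : CylAlg.{u} m} {M : Type u} (R : RelRep A M) (n : ℕ) : Prop :=
  ∀ s ∈ R.cliqueTuples n, ∀ (a : A) (i : Fin m) (l : Fin m → Fin n),
    (∀ j, j ≠ i → l j ≠ l i) → R.Sat (A.cyl i a) (s ∘ l) →
      ∃ t ∈ R.cliqueTuples n, (∀ k, k ≠ l i → t k = s k) ∧ R.Sat a (t ∘ l)

end RelRep

/-- `A` has an `n`-square relativized representation. -/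
def HasSquareRep {m : ℕ} (A : CylAlg.{u} m) (n : ℕ) : Prop :=
  ∃ (M : Type u) (R : RelRep A M), R.IsSquare n

end CylAlg

/-! The central notion is a weak basis: a set of `n`-dimensional networks labelled by ultrafilters
of the algebra, with initial networks and witnesses demanded only for elements. By `mem_CAB_iff`,
the algebras in `CAB` are exactly the cylindric algebras with a weak basis. A basis of an atomic
algebra becomes a weak one through principal ultrafilters, and weak bases pull back along
embeddings. Conversely, closing a weak basis under ultrafilter limits of networks is a compactness
argument that produces witnesses for ultrafilters (`HasWeakBasis.hasUfBasis`). Since the atoms of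
the canonical extension are the singletons of ultrafilters, this is a basis of the canonical
extension, which is complete, atomic and cylindric, and contains the algebra.

Canonicity and the second claim follow at once. For products, take all pullbacks of networks along
the projections. For homomorphic images, the ultrafilters of the image form a generated subframe,
and a network with one label there has all its labels there.

In an `n`-square representation the types of the clique tuples form a weak basis. In the other
direction a basis is unravelled into a tree of finite paths of networks, glued along the nodes that
are kept. A point is named by the path at which it is born, so that the label of a tuple is
independent of the path and every clique lies in a single network.

An algebra with weak bases of all finite dimensions has, for every finite set of Henkin witness
terms, a network satisfying these demands. A limit satisfies all of them, and identifying
interchangeable nodes gives a homomorphism into a full set algebra that does not kill a prescribed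
nonzero element. -/

namespace CylAlg

open Filter

/-! ### Arithmetic of cylindric algebras and of their homomorphisms -/

section Basic

variable {m : ℕ} {A : CylAlg.{u} m}

namespace IsCA

theorem cyl_mono (h : A.IsCA) (i : Fin m) {x y : A} (hxy : x ≤ y) : A.cyl i x ≤ A.cyl i y := by
  have := h.cyl_inf_cyl i x y
  rw [inf_eq_left.2 (hxy.trans (h.le_cyl i y))] at this
  exact inf_eq_left.1 this.symm

theorem cyl_cyl (h : A.IsCA) (i : Fin m) (x : A) : A.cyl i (A.cyl i x) = A.cyl i x := by
  have := h.cyl_inf_cyl i ⊤ x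
  rwa [top_inf_eq, top_le_iff.1 (h.le_cyl i ⊤), top_inf_eq] at this

/-- Cylindrifications are self-conjugate. -/
theorem cyl_inf_eq_bot (h : A.IsCA) (i : Fin m) {x y : A} (hxy : A.cyl i x ⊓ y = ⊥) :
    x ⊓ A.cyl i y = ⊥ := by
  have h1 : A.cyl i y ⊓ A.cyl i x = ⊥ := by
    rw [← h.cyl_inf_cyl, inf_comm, hxy, h.cyl_bot]
  rw [eq_bot_iff, ← h1, inf_comm]
  exact inf_le_inf_left _ (h.le_cyl i x)

theorem le_compl_cyl (h : A.IsCA) (i : Fin m) {x y : A} (hxy : x ≤ (A.cyl i y)ᶜ) :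
    A.cyl i x ≤ (A.cyl i y)ᶜ := by
  rw [le_compl_iff_disjoint_right, disjoint_iff] at hxy ⊢
  rw [← h.cyl_inf_cyl, hxy, h.cyl_bot]

/-- The complement `w` of the right-hand side satisfies `c_i w ≤ w`, so `c_i w` is disjoint from `x
⊔ y`. By self-conjugacy `w` is then disjoint from `c_i (x ⊔ y)`. -/
theorem cyl_sup (h : A.IsCA) (i : Fin m) (x y : A) :
    A.cyl i (x ⊔ y) = A.cyl i x ⊔ A.cyl i y := by
  refine le_antisymm ?_ (sup_le (h.cyl_mono i le_sup_left) (h.cyl_mono i le_sup_right))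
  set w := (A.cyl i x ⊔ A.cyl i y)ᶜ with hw
  have h1 : A.cyl i w ≤ w := by
    rw [hw, compl_sup]
    exact le_inf (h.le_compl_cyl i inf_le_left) (h.le_compl_cyl i inf_le_right)
  have h2 : A.cyl i w ⊓ (x ⊔ y) = ⊥ := by
    rw [eq_bot_iff]
    calc A.cyl i w ⊓ (x ⊔ y) ≤ w ⊓ (A.cyl i x ⊔ A.cyl i y) :=
          inf_le_inf h1 (sup_le_sup (h.le_cyl i x) (h.le_cyl i y))
      _ = ⊥ := by rw [hw, compl_inf_eq_bot]
  have h3 := h.cyl_inf_eq_bot i h2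
  rw [inf_comm, ← disjoint_iff, ← le_compl_iff_disjoint_right, hw, compl_compl] at h3
  exact h3

theorem atom_le_cyl_symm (h : A.IsCA) (i : Fin m) {a b : A} (ha : IsAtom a) (hb : IsAtom b)
    (hab : a ≤ A.cyl i b) : b ≤ A.cyl i a := by
  rcases hb.le_iff.1 (inf_le_left : b ⊓ A.cyl i a ≤ b) with h1 | h1
  · rw [inf_comm] at h1
    have h2 := h.cyl_inf_eq_bot i h1
    exact absurd ((inf_eq_left.2 hab).symm.trans h2) ha.1
  · exact inf_eq_left.1 h1

/-- Self-conjugacy makes `c_i a ⊓ x` nonzero, and any atom below it works by symmetry. Atomicity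
thus replaces complete additivity of `c_i`. -/
theorem exists_atom_le (h : A.IsCA) [hA : IsAtomic A] (i : Fin m) {a x : A} (ha : IsAtom a)
    (hax : a ≤ A.cyl i x) : ∃ b, IsAtom b ∧ b ≤ x ∧ a ≤ A.cyl i b := by
  rcases hA.eq_bot_or_exists_atom_le (A.cyl i a ⊓ x) with h1 | ⟨b, hb, hle⟩
  · have h2 := h.cyl_inf_eq_bot i h1
    exact absurd ((inf_eq_left.2 hax).symm.trans h2) ha.1
  · exact ⟨b, hb, hle.trans inf_le_right,
      h.atom_le_cyl_symm i hb ha (hle.trans inf_le_left)⟩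

/-- A structure that embeds into a cylindric algebra is a cylindric algebra. -/
theorem of_injective (h : A.IsCA) {B : CylAlg.{v} m} {f : B → A} (hf : IsHom f)
    (inj : Function.Injective f) : B.IsCA where
  cyl_bot i := inj (by rw [hf.map_cyl, hf.map_bot, h.cyl_bot])
  le_cyl i x := by
    rw [← inf_eq_left]
    exact inj (by rw [hf.map_inf, hf.map_cyl, inf_eq_left.2 (h.le_cyl i _)])
  cyl_inf_cyl i x y := inj (by
    rw [hf.map_inf, hf.map_cyl, hf.map_inf, hf.map_cyl, hf.map_cyl, h.cyl_inf_cyl])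
  cyl_comm i j x := inj (by
    rw [hf.map_cyl, hf.map_cyl, hf.map_cyl, hf.map_cyl, h.cyl_comm])
  diag_self i := inj (by rw [hf.map_diag, hf.map_top, h.diag_self])
  diag_eq i j k hi hj := inj (by
    rw [hf.map_cyl, hf.map_inf, hf.map_diag, hf.map_diag, hf.map_diag, h.diag_eq i j k hi hj])
  cyl_diag i j x hij := inj (by
    rw [hf.map_inf, hf.map_cyl, hf.map_cyl, hf.map_inf, hf.map_inf, hf.map_compl, hf.map_diag,
      h.cyl_diag i j _ hij, hf.map_bot])

theorem of_surjective (h : A.IsCA) {B : CylAlg.{v} m} {f : A → B} (hf : IsHom f)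
    (surj : Function.Surjective f) : B.IsCA where
  cyl_bot i := by rw [← hf.map_bot, ← hf.map_cyl, h.cyl_bot]
  le_cyl i x := by
    obtain ⟨x, rfl⟩ := surj x
    rw [← inf_eq_left, ← hf.map_cyl, ← hf.map_inf, inf_eq_left.2 (h.le_cyl i _)]
  cyl_inf_cyl i x y := by
    obtain ⟨x, rfl⟩ := surj x
    obtain ⟨y, rfl⟩ := surj y
    rw [← hf.map_cyl, ← hf.map_inf, ← hf.map_cyl, ← hf.map_cyl, ← hf.map_inf, h.cyl_inf_cyl]
  cyl_comm i j x := by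
    obtain ⟨x, rfl⟩ := surj x
    rw [← hf.map_cyl, ← hf.map_cyl, ← hf.map_cyl, ← hf.map_cyl, h.cyl_comm]
  diag_self i := by rw [← hf.map_diag, h.diag_self, hf.map_top]
  diag_eq i j k hi hj := by
    rw [← hf.map_diag, ← hf.map_diag, ← hf.map_diag, ← hf.map_inf, ← hf.map_cyl,
      h.diag_eq i j k hi hj]
  cyl_diag i j x hij := by
    obtain ⟨x, rfl⟩ := surj x
    rw [← hf.map_diag, ← hf.map_compl, ← hf.map_inf, ← hf.map_inf, ← hf.map_cyl, ← hf.map_cyl,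
      ← hf.map_inf, h.cyl_diag i j _ hij, hf.map_bot]

theorem prod {I : Type u} {A : I → CylAlg.{u} m} (h : ∀ j, (A j).IsCA) :
    (CylAlg.prod A).IsCA where
  cyl_bot i := funext fun j => (h j).cyl_bot i
  le_cyl i x := fun j => (h j).le_cyl i (x j)
  cyl_inf_cyl i x y := funext fun j => (h j).cyl_inf_cyl i (x j) (y j)
  cyl_comm i k x := funext fun j => (h j).cyl_comm i k (x j)
  diag_self i := funext fun j => (h j).diag_self i
  diag_eq i k l hi hk := funext fun j => (h j).diag_eq i k l hi hk
  cyl_diag i k x hik := funext fun j => (h j).cyl_diag i k (x j) hik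

theorem fullSetAlg (m : ℕ) (U : Type u) : (fullSetAlg m U).IsCA where
  cyl_bot i := Set.eq_empty_of_forall_notMem (by rintro s ⟨t, ht, -⟩; exact ht)
  le_cyl i x := fun s hs => ⟨s, hs, fun _ _ => rfl⟩
  cyl_inf_cyl i x y := by
    apply Set.ext
    intro s
    constructor
    · rintro ⟨t, ⟨hx, r, hr, hrt⟩, hts⟩
      exact ⟨⟨t, hx, hts⟩, ⟨r, hr, fun j hj => (hrt j hj).trans (hts j hj)⟩⟩
    · rintro ⟨⟨t, hx, hts⟩, ⟨r, hr, hrs⟩⟩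
      exact ⟨t, ⟨hx, r, hr, fun j hj => (hrs j hj).trans (hts j hj).symm⟩, hts⟩
  cyl_comm i j x := by
    have key : ∀ i j : Fin m, ∀ s : Fin m → U,
        (∃ t : Fin m → U, (∃ r ∈ (show Set (Fin m → U) from x), ∀ l, l ≠ j → r l = t l) ∧
          ∀ l, l ≠ i → t l = s l) →
        ∃ t : Fin m → U, (∃ r ∈ (show Set (Fin m → U) from x), ∀ l, l ≠ i → r l = t l) ∧
          ∀ l, l ≠ j → t l = s l := by
      rintro i j s ⟨t, ⟨r, hr, hrt⟩, hts⟩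
      by_cases hij : i = j
      · subst hij
        exact ⟨t, ⟨r, hr, hrt⟩, hts⟩
      · refine ⟨Function.update s j (r j), ⟨r, hr, fun l hl => ?_⟩, fun l hl => by simp [hl]⟩
        by_cases hlj : l = j
        · subst hlj; simp
        · simp [hlj, hrt l hlj, hts l hl]
    exact Set.ext fun s => ⟨key i j s, key j i s⟩
  diag_self i := Set.eq_univ_of_forall fun s => rfl
  diag_eq i j k hi hj := by
    apply Set.ext
    intro s
    constructor
    · intro hs
      refine ⟨Function.update s k (s i), ⟨?_, ?_⟩, fun l hl => by simp [hl]⟩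
      · show Function.update s k (s i) i = Function.update s k (s i) k
        simp [hi.symm]
      · show Function.update s k (s i) k = Function.update s k (s i) j
        simp only [Function.update_self, Function.update_of_ne hj.symm]
        exact hs
    · rintro ⟨t, ⟨h1, h2⟩, hts⟩
      show s i = s j
      rw [← hts i hi.symm, ← hts j hj.symm]
      exact Eq.trans h1 h2
  cyl_diag i j x hij := by
    apply Set.eq_empty_of_forall_notMem
    rintro s ⟨⟨t, ⟨h1, h2⟩, hts⟩, ⟨r, ⟨h3, h4⟩, hrs⟩⟩
    have htr : t = r := by
      funext l
      by_cases hl : l = i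
      · subst hl
        calc t l = t j := h1
          _ = s j := hts j hij.symm
          _ = r j := (hrs j hij.symm).symm
          _ = r l := Eq.symm h3
      · exact (hts l hl).trans (hrs l hl).symm
    subst htr
    exact h4 h2

end IsCA

theorem IsHom.monotone {B : CylAlg.{v} m} {f : A → B} (hf : IsHom f) {x y : A} (h : x ≤ y) :
    f x ≤ f y := by
  rw [← inf_eq_left, ← hf.map_inf, inf_eq_left.2 h]

theorem IsHom.comp {B : CylAlg.{v} m} {C : CylAlg.{u} m} {f : A → B} {g : B → C} (hg : IsHom g)
    (hf : IsHom f) : IsHom (fun x => g (f x)) where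
  map_bot := by rw [hf.map_bot, hg.map_bot]
  map_top := by rw [hf.map_top, hg.map_top]
  map_sup x y := by rw [hf.map_sup, hg.map_sup]
  map_inf x y := by rw [hf.map_inf, hg.map_inf]
  map_compl x := by rw [hf.map_compl, hg.map_compl]
  map_cyl i x := by rw [hf.map_cyl, hg.map_cyl]
  map_diag i j := by rw [hf.map_diag, hg.map_diag]

/-- A homomorphism is injective as soon as its kernel is trivial. -/
theorem IsHom.injective_of_ne_bot {B : CylAlg.{v} m} {f : A → B} (hf : IsHom f)
    (h : ∀ a : A, a ≠ ⊥ → f a ≠ ⊥) : Function.Injective f := by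
  have key : ∀ x y : A, f x = f y → x ≤ y := by
    intro x y hxy
    by_contra hle
    refine h (x ⊓ yᶜ) (fun h0 => hle ?_) ?_
    · rwa [← disjoint_iff, disjoint_compl_right_iff] at h0
    · rw [hf.map_inf, hf.map_compl, hxy, inf_compl_eq_bot]
  exact fun x y hxy => le_antisymm (key x y hxy) (key y x hxy.symm)

end Basic

/-! ### The ultrafilter frame -/

namespace Uf

variable {m : ℕ} {A : CylAlg.{u} m}

@[ext]
theorem ext {μ ν : Uf A} (h : ∀ a, a ∈ μ.sets ↔ a ∈ ν.sets) : μ = ν := by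
  have : μ.sets = ν.sets := Set.ext h
  cases μ; cases ν; cases this; rfl

theorem compl_mem_iff (μ : Uf A) (a : A) : aᶜ ∈ μ.sets ↔ a ∉ μ.sets := by
  refine ⟨fun h1 h2 => μ.bot_notMem ?_, fun h => (μ.mem_or_compl_mem a).resolve_left h⟩
  rw [← inf_compl_eq_bot (a := a)]
  exact μ.inf_mem h2 h1

theorem inf_mem_iff (μ : Uf A) (a b : A) : a ⊓ b ∈ μ.sets ↔ a ∈ μ.sets ∧ b ∈ μ.sets :=
  ⟨fun h => ⟨μ.up_closed h inf_le_left, μ.up_closed h inf_le_right⟩, fun h => μ.inf_mem h.1 h.2⟩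

theorem sup_mem_iff (μ : Uf A) (a b : A) : a ⊔ b ∈ μ.sets ↔ a ∈ μ.sets ∨ b ∈ μ.sets := by
  rw [← not_iff_not, ← compl_mem_iff, compl_sup, inf_mem_iff, compl_mem_iff, compl_mem_iff, not_or]

theorem eq_of_subset {μ ν : Uf A} (h : ∀ a ∈ μ.sets, a ∈ ν.sets) : μ = ν := by
  ext a
  refine ⟨h a, fun ha => ?_⟩
  by_contra hn
  exact (ν.compl_mem_iff a).1 (h _ ((μ.compl_mem_iff a).2 hn)) ha

/-- The ultrafilter theorem. -/
theorem exists_of_filter (S : Set A) (htop : ⊤ ∈ S) (hinf : ∀ x ∈ S, ∀ y ∈ S, x ⊓ y ∈ S)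
    (hbot : ⊥ ∉ S) : ∃ μ : Uf A, S ⊆ μ.sets := by
  let T : Set A := {y | ∃ x ∈ S, x ≤ y}
  have hT : Order.IsPFilter T := by
    refine Order.IsPFilter.of_def ⟨⊤, ⊤, htop, le_rfl⟩ ?_ ?_
    · rintro x ⟨x', hx, hx'⟩ y ⟨y', hy, hy'⟩
      exact ⟨x ⊓ y, ⟨x' ⊓ y', hinf _ hx _ hy, inf_le_inf hx' hy'⟩, inf_le_left, inf_le_right⟩
    · rintro x y hxy ⟨x', hx, hx'⟩
      exact ⟨x', hx, hx'.trans hxy⟩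
  have hdis : Disjoint (hT.toPFilter : Set A) ((⊥ : Order.Ideal A) : Set A) := by
    rw [Set.disjoint_left]
    rintro y ⟨x, hx, hxy⟩ hy
    have h1 : y ≤ ⊥ := hy
    have h2 : x = ⊥ := le_bot_iff.1 (le_trans hxy h1)
    exact hbot (h2 ▸ hx)
  obtain ⟨J, hJ, -, hd⟩ := DistribLattice.prime_ideal_of_disjoint_filter_ideal hdis
  have hp := hJ
  refine ⟨⟨(J : Set A)ᶜ, ?_, ?_, ?_, ?_, ?_⟩, ?_⟩
  · exact fun h => hp.1.ne_univ (Set.eq_univ_of_forall fun x => J.lower le_top h)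
  · exact fun h => h J.bot_mem
  · exact fun hx hxy hy => hx (J.lower hxy hy)
  · exact fun hx hy h => (hp.mem_or_mem h).elim hx hy
  · intro x
    by_contra hx
    push Not at hx
    have h1 : x ∈ J := by simpa using hx.1
    have h2 : xᶜ ∈ J := by simpa using hx.2
    have h3 : (⊤ : A) ∈ J := by
      rw [← sup_compl_eq_top (x := x)]
      exact J.sup_mem h1 h2
    exact hp.1.ne_univ (Set.eq_univ_of_forall fun x => J.lower le_top h3)
  · exact fun x hx hxJ => Set.disjoint_left.1 hd (show x ∈ T from ⟨x, hx, le_rfl⟩) hxJ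

theorem exists_mem {a : A} (ha : a ≠ ⊥) : ∃ μ : Uf A, a ∈ μ.sets := by
  obtain ⟨μ, hμ⟩ := exists_of_filter {x : A | a ≤ x} le_top (fun x hx y hy => le_inf hx hy)
    (fun h => ha (le_bot_iff.1 h))
  exact ⟨μ, hμ le_rfl⟩

/-- The accessibility relation of the ultrafilter frame. -/
def Rel (i : Fin m) (μ ν : Uf A) : Prop := ∀ a ∈ ν.sets, A.cyl i a ∈ μ.sets

theorem rel_refl (h : A.IsCA) (i : Fin m) (μ : Uf A) : Rel i μ μ :=
  fun a ha => μ.up_closed ha (h.le_cyl i a)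

theorem Rel.symm (h : A.IsCA) {i : Fin m} {μ ν : Uf A} (hr : Rel i μ ν) : Rel i ν μ := by
  intro b hb
  by_contra hn
  have h1 := hr _ ((ν.compl_mem_iff _).2 hn)
  have h2 := μ.up_closed h1 (h.le_compl_cyl i le_rfl)
  exact (μ.compl_mem_iff _).1 h2 (μ.up_closed hb (h.le_cyl i b))

theorem Rel.trans (h : A.IsCA) {i : Fin m} {μ ν ρ : Uf A} (hr : Rel i μ ν) (hs : Rel i ν ρ) :
    Rel i μ ρ := by
  intro a ha
  rw [← h.cyl_cyl]
  exact hr _ (hs a ha)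

/-- A successor of `μ` must contain every `q` with `c_i qᶜ ∉ μ`. These `q` are closed under meets by
additivity. If some `p ∈ P` were disjoint from such a `q`, then `p ≤ qᶜ` would put `c_i qᶜ` into
`μ`. -/
theorem exists_rel (h : A.IsCA) (i : Fin m) (μ : Uf A) (P : Set A) (htop : ⊤ ∈ P)
    (hinf : ∀ x ∈ P, ∀ y ∈ P, x ⊓ y ∈ P) (hP : ∀ p ∈ P, A.cyl i p ∈ μ.sets) :
    ∃ ν : Uf A, P ⊆ ν.sets ∧ Rel i μ ν := by
  have h0 : A.cyl i (⊤ : A)ᶜ ∉ μ.sets := by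
    rw [compl_top, h.cyl_bot]; exact μ.bot_notMem
  obtain ⟨ν, hν⟩ := exists_of_filter {x : A | ∃ p ∈ P, ∃ q, A.cyl i qᶜ ∉ μ.sets ∧ x = p ⊓ q}
    ⟨⊤, htop, ⊤, h0, by simp⟩
    (by
      rintro _ ⟨p, hp, q, hq, rfl⟩ _ ⟨p', hp', q', hq', rfl⟩
      refine ⟨p ⊓ p', hinf _ hp _ hp', q ⊓ q', ?_, inf_inf_inf_comm ..⟩
      rw [compl_inf, h.cyl_sup, sup_mem_iff]
      tauto)
    (by
      rintro ⟨p, hp, q, hq, h1⟩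
      refine hq (μ.up_closed (hP p hp) (h.cyl_mono i ?_))
      rw [le_compl_iff_disjoint_right, disjoint_iff, h1])
  refine ⟨ν, fun p hp => hν ⟨p, hp, ⊤, h0, by simp⟩, fun a ha => ?_⟩
  by_contra hn
  have h1 : aᶜ ∈ ν.sets := hν ⟨⊤, htop, aᶜ, by rwa [compl_compl], by simp⟩
  exact (ν.compl_mem_iff a).1 h1 ha

theorem exists_rel_mem (h : A.IsCA) {i : Fin m} {μ : Uf A} {a : A} (ha : A.cyl i a ∈ μ.sets) :
    ∃ ν : Uf A, a ∈ ν.sets ∧ Rel i μ ν := by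
  obtain ⟨ν, h1, h2⟩ := exists_rel h i μ {x : A | a ≤ x} le_top (fun x hx y hy => le_inf hx hy)
    (fun p hp => μ.up_closed ha (h.cyl_mono i hp))
  exact ⟨ν, h1 le_rfl, h2⟩

end Uf

/-! ### The canonical extension is cylindric and contains the algebra -/

section CanExt

variable {m : ℕ} {A : CylAlg.{u} m}

theorem IsCA.canExt (h : A.IsCA) : A.canExt.IsCA where
  cyl_bot i := Set.eq_empty_of_forall_notMem (by rintro s ⟨t, ht, -⟩; exact ht)
  le_cyl i x := fun μ hμ => ⟨μ, hμ, Uf.rel_refl h i μ⟩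
  cyl_inf_cyl i x y := by
    apply Set.ext
    intro μ
    constructor
    · rintro ⟨ν, ⟨hx, ρ, hρ, hνρ⟩, hμν⟩
      exact ⟨⟨ν, hx, hμν⟩, ⟨ρ, hρ, Uf.Rel.trans h hμν hνρ⟩⟩
    · rintro ⟨⟨ν, hx, hμν⟩, ⟨ρ, hρ, hμρ⟩⟩
      exact ⟨ν, ⟨hx, ρ, hρ, Uf.Rel.trans h (Uf.Rel.symm h hμν) hμρ⟩, hμν⟩
  cyl_comm i j x := by
    -- The accessibility relations commute: the intermediate point is a `j`-successor of `μ`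
    -- containing `c_i c` for all `c ∈ ρ`.
    have key : ∀ i j : Fin m, ∀ μ ν ρ : Uf A, Uf.Rel i μ ν → Uf.Rel j ν ρ →
        ∃ ν', Uf.Rel j μ ν' ∧ Uf.Rel i ν' ρ := by
      intro i j μ ν ρ h1 h2
      obtain ⟨ν', h3, h4⟩ := Uf.exists_rel h j μ {p : A | ∃ c ∈ ρ.sets, A.cyl i c ≤ p}
        ⟨⊤, ρ.top_mem, le_top⟩
        (by
          rintro x ⟨c, hc, hx⟩ y ⟨d, hd, hy⟩
          exact ⟨c ⊓ d, ρ.inf_mem hc hd, le_inf ((h.cyl_mono i inf_le_left).trans hx)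
            ((h.cyl_mono i inf_le_right).trans hy)⟩)
        (by
          rintro p ⟨c, hc, hp⟩
          refine μ.up_closed ?_ (h.cyl_mono j hp)
          rw [h.cyl_comm]
          exact h1 _ (h2 c hc))
      exact ⟨ν', h4, fun c hc => h3 ⟨c, hc, le_rfl⟩⟩
    apply Set.ext
    intro μ
    constructor
    · rintro ⟨ν, ⟨ρ, hρ, h2⟩, h1⟩
      obtain ⟨ν', h3, h4⟩ := key i j μ ν ρ h1 h2
      exact ⟨ν', ⟨ρ, hρ, h4⟩, h3⟩
    · rintro ⟨ν, ⟨ρ, hρ, h2⟩, h1⟩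
      obtain ⟨ν', h3, h4⟩ := key j i μ ν ρ h1 h2
      exact ⟨ν', ⟨ρ, hρ, h4⟩, h3⟩
  diag_self i := Set.eq_univ_of_forall fun μ => by
    show A.diag i i ∈ μ.sets
    rw [h.diag_self]; exact μ.top_mem
  diag_eq i j k hi hj := by
    apply Set.ext
    intro μ
    constructor
    · intro (hμ : A.diag i j ∈ μ.sets)
      rw [h.diag_eq i j k hi hj] at hμ
      obtain ⟨ν, h1, h2⟩ := Uf.exists_rel_mem h hμ
      exact ⟨ν, (Uf.inf_mem_iff _ _ _).1 h1, h2⟩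
    · rintro ⟨ν, h1, h2⟩
      show A.diag i j ∈ μ.sets
      rw [h.diag_eq i j k hi hj]
      exact h2 _ ((Uf.inf_mem_iff _ _ _).2 h1)
  cyl_diag i j x hij := by
    apply Set.eq_empty_of_forall_notMem
    rintro μ ⟨⟨ν, ⟨h1, h2⟩, hν⟩, ⟨ρ, ⟨h3, h4⟩, hρ⟩⟩
    -- An `i`-successor of `μ` containing `d_ij` is unique, since the last axiom forbids an element
    -- that separates two of them.
    have hνρ : ν = ρ := by
      refine Uf.eq_of_subset fun a ha => ?_
      by_contra hn
      have e1 := hν _ ((Uf.inf_mem_iff _ _ _).2 ⟨h1, ha⟩)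
      have e2 := hρ _ ((Uf.inf_mem_iff _ _ _).2 ⟨h3, (Uf.compl_mem_iff _ _).2 hn⟩)
      have e3 := μ.inf_mem e1 e2
      rw [h.cyl_diag i j a hij] at e3
      exact μ.bot_notMem e3
    subst hνρ
    exact h4 h2

theorem embeds_canExt (h : A.IsCA) : Embeds A A.canExt := by
  let f : A → A.canExt := fun a => ({μ : Uf A | a ∈ μ.sets} : Set (Uf A))
  have hf : IsHom f :=
    { map_bot := Set.eq_empty_of_forall_notMem fun μ => μ.bot_notMem
      map_top := Set.eq_univ_of_forall fun μ => μ.top_mem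
      map_sup := fun x y => Set.ext fun μ => μ.sup_mem_iff x y
      map_inf := fun x y => Set.ext fun μ => μ.inf_mem_iff x y
      map_compl := fun x => Set.ext fun μ => μ.compl_mem_iff x
      map_cyl := fun i x => Set.ext fun μ =>
        ⟨fun hμ => Uf.exists_rel_mem h hμ, fun ⟨_, h1, h2⟩ => h2 _ h1⟩
      map_diag := fun _ _ => rfl }
  refine ⟨f, hf, hf.injective_of_ne_bot fun a ha h0 => ?_⟩
  obtain ⟨μ, hμ⟩ := Uf.exists_mem ha
  have : μ ∈ (∅ : Set (Uf A)) := by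
    have h1 : ({μ : Uf A | a ∈ μ.sets} : Set (Uf A)) = ∅ := h0
    rw [← h1]; exact hμ
  exact this

end CanExt

/-! ### Ultrafilter-labelled networks and the two kinds of bases -/

section Networks

variable {m : ℕ} {A : CylAlg.{u} m}

namespace Uf

/-- The preimage of an ultrafilter under a homomorphism. -/
def comap {B : CylAlg.{v} m} {f : A → B} (hf : IsHom f) (μ : Uf B) : Uf A where
  sets := {a | f a ∈ μ.sets}
  top_mem := by
    show f ⊤ ∈ μ.sets
    rw [hf.map_top]; exact μ.top_mem
  bot_notMem := by
    show f ⊥ ∉ μ.sets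
    rw [hf.map_bot]; exact μ.bot_notMem
  up_closed hx hxy := μ.up_closed hx (hf.monotone hxy)
  inf_mem {x y} hx hy := by
    show f (x ⊓ y) ∈ μ.sets
    rw [hf.map_inf]; exact μ.inf_mem hx hy
  mem_or_compl_mem x := by
    show f x ∈ μ.sets ∨ f xᶜ ∈ μ.sets
    rw [hf.map_compl]; exact μ.mem_or_compl_mem _

theorem mem_comap {B : CylAlg.{v} m} {f : A → B} (hf : IsHom f) {μ : Uf B} {a : A} :
    a ∈ (comap hf μ).sets ↔ f a ∈ μ.sets := Iff.rfl

theorem comap_injective {B : CylAlg.{v} m} {f : A → B} (hf : IsHom f)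
    (surj : Function.Surjective f) : Function.Injective (comap hf) := by
  intro μ ν h
  refine eq_of_subset fun b hb => ?_
  obtain ⟨a, rfl⟩ := surj b
  rw [← mem_comap hf] at hb ⊢
  rwa [← h]

theorem Rel.comap {B : CylAlg.{v} m} {f : A → B} (hf : IsHom f) {i : Fin m} {μ ν : Uf B}
    (h : Rel i μ ν) : Rel i (comap hf μ) (comap hf ν) := by
  intro a ha
  rw [mem_comap, hf.map_cyl]
  exact h _ ha

theorem Rel.of_comap {B : CylAlg.{v} m} {f : A → B} (hf : IsHom f)
    (surj : Function.Surjective f) {i : Fin m} {μ ν : Uf B}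
    (h : Rel i (Uf.comap hf μ) (Uf.comap hf ν)) : Rel i μ ν := by
  intro b hb
  obtain ⟨a, rfl⟩ := surj b
  rw [← hf.map_cyl]
  exact h a hb

/-- The ultrafilters of a homomorphic image form a generated subframe. -/
theorem exists_comap_eq_of_rel (hA : A.IsCA) {B : CylAlg.{v} m} {f : A → B} (hf : IsHom f)
    (surj : Function.Surjective f) {i : Fin m} {μ : Uf B} {ν : Uf A}
    (h : Rel i ν (comap hf μ)) : ∃ ρ : Uf B, comap hf ρ = ν := by
  have hB := hA.of_surjective hf surj
  -- By symmetry of the frame, a kernel element of `ν` would put `c_i ⊥ = ⊥` into `μ`. Hence the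
  -- image of `ν` still generates a proper filter.
  have key : ∀ a : A, f a = ⊥ → a ∉ ν.sets := by
    intro a ha hν
    have h1 : f (A.cyl i a) ∈ μ.sets := h.symm hA a hν
    rw [hf.map_cyl, ha, hB.cyl_bot] at h1
    exact μ.bot_notMem h1
  have key' : ∀ a b : A, a ∈ ν.sets → f a ≤ f b → b ∈ ν.sets := by
    intro a b ha hab
    by_contra hb
    refine key (a ⊓ bᶜ) ?_ (ν.inf_mem ha ((ν.compl_mem_iff b).2 hb))
    rw [hf.map_inf, hf.map_compl, ← disjoint_iff, disjoint_compl_right_iff]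
    exact hab
  obtain ⟨ρ, hρ⟩ := exists_of_filter {b : B | ∃ a ∈ ν.sets, f a = b} ⟨⊤, ν.top_mem, hf.map_top⟩
    (by
      rintro _ ⟨a, ha, rfl⟩ _ ⟨b, hb, rfl⟩
      exact ⟨a ⊓ b, ν.inf_mem ha hb, hf.map_inf a b⟩)
    (by
      rintro ⟨a, ha, h0⟩
      exact key a h0 ha)
  exact ⟨ρ, (eq_of_subset fun a ha => (hρ ⟨a, ha, rfl⟩ : f a ∈ ρ.sets)).symm⟩

/-- The limit of a family of ultrafilters of `A` along an ultrafilter on the index set. -/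
def lim {J : Type*} (U : Ultrafilter J) (g : J → Uf A) : Uf A where
  sets := {a | ∀ᶠ j in U, a ∈ (g j).sets}
  top_mem := Eventually.of_forall fun j => (g j).top_mem
  bot_notMem h := by
    obtain ⟨j, hj⟩ := h.exists
    exact (g j).bot_notMem hj
  up_closed hx hxy := hx.mono fun j hj => (g j).up_closed hj hxy
  inf_mem hx hy := (hx.and hy).mono fun j hj => (g j).inf_mem hj.1 hj.2
  mem_or_compl_mem x := by
    exact Ultrafilter.eventually_or.1 (Eventually.of_forall fun j => (g j).mem_or_compl_mem x)

theorem mem_lim {J : Type*} {U : Ultrafilter J} {g : J → Uf A} {a : A} :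
    a ∈ (lim U g).sets ↔ ∀ᶠ j in U, a ∈ (g j).sets := Iff.rfl

theorem lim_congr {J : Type*} {U : Ultrafilter J} {g g' : J → Uf A}
    (h : ∀ᶠ j in U, g j = g' j) : lim U g = lim U g' :=
  eq_of_subset fun a ha => by
    filter_upwards [h, mem_lim.1 ha] with j h1 h2
    rwa [← h1]

/-- The principal ultrafilter of an atom. -/
def ofAtom {b : A} (hb : IsAtom b) : Uf A where
  sets := {a | b ≤ a}
  top_mem := le_top
  bot_notMem h := hb.1 (le_bot_iff.1 h)
  up_closed hx hxy := le_trans hx hxy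
  inf_mem hx hy := le_inf hx hy
  mem_or_compl_mem x := by
    rcases hb.le_iff.1 (inf_le_left : b ⊓ x ≤ b) with h | h
    · exact Or.inr (le_compl_iff_disjoint_right.2 (disjoint_iff.2 h))
    · exact Or.inl (inf_eq_left.1 h)

theorem ofAtom_congr {b c : A} (hb : IsAtom b) (hc : IsAtom c) (h : b = c) :
    ofAtom hb = ofAtom hc := by
  subst h; rfl

end Uf

/-- Networks labelled by ultrafilters. -/
structure IsUfNetwork (A : CylAlg.{u} m) {X : Type v} (N : (Fin m → X) → Uf A) : Prop where
  diag : ∀ δ i j, A.diag i j ∈ (N (Function.update δ i (δ j))).sets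
  cyl : ∀ δ i (d : X), Uf.Rel i (N (Function.update δ i d)) (N δ)
  congr : ∀ δ i j, A.diag i j ∈ (N δ).sets →
    ∀ ε k, ε k = δ i → N (Function.update ε k (δ j)) = N ε

namespace IsUfNetwork

variable {X : Type*}

theorem comap {B : CylAlg.{v} m} {f : A → B} (hf : IsHom f) {N : (Fin m → X) → Uf B}
    (hN : IsUfNetwork B N) : IsUfNetwork A (fun δ => Uf.comap hf (N δ)) where
  diag δ i j := by
    rw [Uf.mem_comap, hf.map_diag]
    exact hN.diag δ i j
  cyl δ i d := (hN.cyl δ i d).comap hf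
  congr δ i j h ε k hε := by
    rw [Uf.mem_comap, hf.map_diag] at h
    rw [hN.congr δ i j h ε k hε]

theorem of_comap {B : CylAlg.{v} m} {f : A → B} (hf : IsHom f) (surj : Function.Surjective f)
    {N : (Fin m → X) → Uf B} (hN : IsUfNetwork A (fun δ => Uf.comap hf (N δ))) :
    IsUfNetwork B N where
  diag δ i j := by
    have := hN.diag δ i j
    rwa [Uf.mem_comap, hf.map_diag] at this
  cyl δ i d := (hN.cyl δ i d).of_comap hf surj
  congr δ i j h ε k hε := by
    rw [← hf.map_diag, ← Uf.mem_comap hf] at h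
    exact Uf.comap_injective hf surj (hN.congr δ i j h ε k hε)

theorem comp {Y : Type*} {N : (Fin m → X) → Uf A} (hN : IsUfNetwork A N) (e : Y → X) :
    IsUfNetwork A (fun δ : Fin m → Y => N (e ∘ δ)) where
  diag δ i j := by
    rw [Function.comp_update]
    exact hN.diag (e ∘ δ) i j
  cyl δ i d := by
    rw [Function.comp_update]
    exact hN.cyl (e ∘ δ) i (e d)
  congr δ i j h ε k hε := by
    show N (e ∘ Function.update ε k (δ j)) = _
    rw [Function.comp_update]
    exact hN.congr (e ∘ δ) i j h (e ∘ ε) k (congrArg e hε)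

theorem lim {J : Type*} {U : Ultrafilter J} {N : J → (Fin m → X) → Uf A}
    (hN : ∀ᶠ j in U, IsUfNetwork A (N j)) :
    IsUfNetwork A (fun δ => Uf.lim U fun j => N j δ) where
  diag δ i k := hN.mono fun j hj => hj.diag δ i k
  cyl δ i d := fun a ha => by
    filter_upwards [hN, Uf.mem_lim.1 ha] with j h1 h2
    exact h1.cyl δ i d a h2
  congr δ i k h ε l hε := by
    apply Uf.lim_congr
    filter_upwards [hN, Uf.mem_lim.1 h] with j h1 h2
    exact h1.congr δ i k h2 ε l hε

/-- All labels of a network belong to the same inner subframe. -/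
theorem label_induction {N : (Fin m → X) → Uf A} (hN : IsUfNetwork A N) {p : Uf A → Prop}
    (hp : ∀ i μ ν, Uf.Rel i ν μ → p μ → p ν) {δ : Fin m → X} (h : p (N δ)) (ε : Fin m → X) :
    p (N ε) := by
  have key : ∀ s : Finset (Fin m), p (N (s.piecewise ε δ)) := by
    intro s
    induction s using Finset.induction_on with
    | empty => simpa using h
    | insert j s hj ih =>
      rw [Finset.piecewise_insert]
      exact hp j _ _ (hN.cyl _ j _) ih
  simpa using key Finset.univ

end IsUfNetwork

/-- A set of networks labelled by ultrafilters, with witnesses for elements of the algebra. -/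
structure IsWeakBasis (A : CylAlg.{u} m) {n : ℕ} (hmn : m ≤ n)
    (H : Set ((Fin m → Fin n) → Uf A)) : Prop where
  network : ∀ N ∈ H, IsUfNetwork A N
  start : ∀ a : A, a ≠ ⊥ → ∃ N ∈ H, a ∈ (N (Fin.castLE hmn)).sets
  witness : ∀ N ∈ H, ∀ (x : Fin m → Fin n) (i : Fin m) (a : A), A.cyl i a ∈ (N x).sets →
    ∀ k : Fin n, (∀ j, j ≠ i → x j ≠ k) →
      ∃ N' ∈ H, (∀ y : Fin m → Fin n, (∀ j, y j ≠ k) → N' y = N y) ∧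
        a ∈ (N' (Function.update x i k)).sets

def HasWeakBasis (A : CylAlg.{u} m) {n : ℕ} (hmn : m ≤ n) : Prop :=
  ∃ H : Set ((Fin m → Fin n) → Uf A), IsWeakBasis A hmn H

/-- A set of networks labelled by ultrafilters, with witnesses for ultrafilters. -/
structure IsUfBasis (A : CylAlg.{u} m) {n : ℕ} (hmn : m ≤ n)
    (H : Set ((Fin m → Fin n) → Uf A)) : Prop where
  network : ∀ N ∈ H, IsUfNetwork A N
  start : ∀ μ : Uf A, ∃ N ∈ H, N (Fin.castLE hmn) = μ
  witness : ∀ N ∈ H, ∀ (x : Fin m → Fin n) (i : Fin m) (μ : Uf A), Uf.Rel i (N x) μ →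
    ∀ k : Fin n, (∀ j, j ≠ i → x j ≠ k) →
      ∃ N' ∈ H, (∀ y : Fin m → Fin n, (∀ j, y j ≠ k) → N' y = N y) ∧
        N' (Function.update x i k) = μ

def HasUfBasis (A : CylAlg.{u} m) {n : ℕ} (hmn : m ≤ n) : Prop :=
  ∃ H : Set ((Fin m → Fin n) → Uf A), IsUfBasis A hmn H

end Networks

/-! ### Transfer of bases and the characterization of `CAB` -/

section Transfer

variable {m n : ℕ} {A : CylAlg.{u} m} {hmn : m ≤ n}

theorem HasWeakBasis.comap {B : CylAlg.{v} m} (hB : B.HasWeakBasis hmn) {f : A → B}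
    (hf : IsHom f) (inj : Function.Injective f) : A.HasWeakBasis hmn := by
  obtain ⟨H, hH⟩ := hB
  refine ⟨{N' | ∃ N ∈ H, N' = fun δ => Uf.comap hf (N δ)}, ?_, ?_, ?_⟩
  · rintro _ ⟨N, hN, rfl⟩
    exact (hH.network N hN).comap hf
  · intro a ha
    obtain ⟨N, hN, h⟩ := hH.start (f a) (fun h => ha (inj (h.trans hf.map_bot.symm)))
    exact ⟨_, ⟨N, hN, rfl⟩, h⟩
  · rintro _ ⟨N, hN, rfl⟩ x i a h k hk
    rw [Uf.mem_comap, hf.map_cyl] at h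
    obtain ⟨N', hN', h1, h2⟩ := hH.witness N hN x i (f a) h k hk
    exact ⟨_, ⟨N', hN', rfl⟩, fun y hy => congrArg _ (h1 y hy), h2⟩

theorem HasBasis.hasWeakBasis (hA : A.IsCA) (hat : IsAtomic A) (hb : A.HasBasis hmn) :
    A.HasWeakBasis hmn := by
  obtain ⟨H, hH⟩ := hb
  refine ⟨{N' | ∃ N, ∃ h : N ∈ H, N' = fun δ => Uf.ofAtom ((hH.network N h).atom δ)}, ?_, ?_, ?_⟩
  · rintro _ ⟨N, hN, rfl⟩
    have hnet := hH.network N hN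
    exact ⟨fun δ i j => hnet.diag δ i j,
      fun δ i d a ha => (hnet.cyl δ i d).trans (hA.cyl_mono i ha),
      fun δ i j h ε k hε => Uf.ofAtom_congr _ _ (hnet.congr δ i j h ε k hε)⟩
  · intro a ha
    obtain ⟨b, hb, hba⟩ := (hat.eq_bot_or_exists_atom_le a).resolve_left ha
    obtain ⟨N, hN, h⟩ := hH.atom b hb
    exact ⟨_, ⟨N, hN, rfl⟩, h.trans_le hba⟩
  · rintro _ ⟨N, hN, rfl⟩ x i a h k hk
    obtain ⟨b, hb, hba, hNb⟩ := hA.exists_atom_le i ((hH.network N hN).atom x) h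
    obtain ⟨N', hN', h1, h2⟩ := hH.witness N hN x i b hb hNb k hk
    exact ⟨_, ⟨N', hN', rfl⟩, fun y hy => Uf.ofAtom_congr _ _ (h1 y hy), h2.trans_le hba⟩

/-- Each network stays within one factor, because a nonzero element is already nonzero in some
coordinate. -/
theorem HasWeakBasis.prod {I : Type u} {A : I → CylAlg.{u} m}
    (h : ∀ j, (A j).HasWeakBasis hmn) : (CylAlg.prod A).HasWeakBasis hmn := by
  choose H hH using h
  have hp : ∀ j, IsHom (A := CylAlg.prod A) (B := A j) (fun x => x j) := fun j =>
    { map_bot := rfl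
      map_top := rfl
      map_sup := fun _ _ => rfl
      map_inf := fun _ _ => rfl
      map_compl := fun _ => rfl
      map_cyl := fun _ _ => rfl
      map_diag := fun _ _ => rfl }
  refine ⟨{N' | ∃ j, ∃ N ∈ H j, N' = fun δ => Uf.comap (hp j) (N δ)}, ?_, ?_, ?_⟩
  · rintro _ ⟨j, N, hN, rfl⟩
    exact ((hH j).network N hN).comap (hp j)
  · intro a ha
    have : ∃ j, a j ≠ ⊥ := by
      by_contra hn
      push Not at hn
      exact ha (funext hn)
    obtain ⟨j, hj⟩ := this
    obtain ⟨N, hN, h⟩ := (hH j).start (a j) hj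
    exact ⟨_, ⟨j, N, hN, rfl⟩, h⟩
  · rintro _ ⟨j, N, hN, rfl⟩ x i a h k hk
    obtain ⟨N', hN', h1, h2⟩ := (hH j).witness N hN x i (a j) h k hk
    exact ⟨_, ⟨j, N', hN', rfl⟩, fun y hy => congrArg _ (h1 y hy), h2⟩

/-- An assignment `s` of points to the `n` nodes is a network: label `δ` by the principal
ultrafilter of `s ∘ δ`. -/
theorem hasWeakBasis_fullSetAlg (hm : 0 < m) (hmn : m ≤ n) (U : Type u) :
    (fullSetAlg m U).HasWeakBasis hmn := by
  let P : (Fin m → U) → Uf (fullSetAlg m U) := fun s =>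
    { sets := {X : Set (Fin m → U) | s ∈ X}
      top_mem := Set.mem_univ s
      bot_notMem := Set.notMem_empty s
      up_closed := fun hx hxy => hxy hx
      inf_mem := fun hx hy => ⟨hx, hy⟩
      mem_or_compl_mem := fun X => Classical.em (s ∈ (show Set (Fin m → U) from X)) }
  refine ⟨{N | ∃ s : Fin n → U, N = fun δ => P (s ∘ δ)}, ?_, ?_, ?_⟩
  · rintro _ ⟨s, rfl⟩
    refine ⟨fun δ i j => ?_, fun δ i d a ha => ?_, fun δ i j h ε k hε => ?_⟩
    · show (s ∘ Function.update δ i (δ j)) i = (s ∘ Function.update δ i (δ j)) j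
      by_cases hij : j = i
      · rw [hij]
      · simp [hij]
    · exact ⟨s ∘ δ, ha, fun j hj => by simp [hj]⟩
    · have h' : s (δ i) = s (δ j) := h
      show P (s ∘ Function.update ε k (δ j)) = P (s ∘ ε)
      rw [Function.comp_update, ← h', ← hε]
      exact congrArg P (Function.update_eq_self k (s ∘ ε))
  · intro a ha
    obtain ⟨s, hs⟩ := Set.nonempty_iff_ne_empty.2 ha
    -- The nodes beyond the first `m` are free; they all repeat the point `s 0`.
    refine ⟨_, ⟨fun k => if h : k.1 < m then s ⟨k.1, h⟩ else s ⟨0, hm⟩, rfl⟩, ?_⟩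
    show ((fun k : Fin n => if h : k.1 < m then s ⟨k.1, h⟩ else s ⟨0, hm⟩) ∘ Fin.castLE hmn) ∈
      (show Set (Fin m → U) from a)
    convert hs using 1
    funext j
    simp
  · rintro _ ⟨s, rfl⟩ x i a ⟨t, ht, hts⟩ k hk
    refine ⟨_, ⟨Function.update s k (t i), rfl⟩, fun y hy => congrArg P ?_, ?_⟩
    · funext j
      simp [hy j]
    · show Function.update s k (t i) ∘ Function.update x i k ∈ (show Set (Fin m → U) from a)
      convert ht using 1
      funext j
      by_cases hj : j = i
      · subst hj; simp
      · simp [hj, hk j hj, hts j hj]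

/-- The new basis consists of all limits of members of `H`, taken along ultrafilters concentrated on
`H`. To meet a demand given by an ultrafilter `μ`, collect the demands for its elements: finitely
many reduce to one by taking meets, so the corresponding sets of networks generate a proper filter.
-/
theorem HasWeakBasis.hasUfBasis (h : A.HasWeakBasis hmn) : A.HasUfBasis hmn := by
  obtain ⟨H, hH⟩ := h
  refine ⟨{N | ∃ U : Ultrafilter ((Fin m → Fin n) → Uf A), H ∈ U ∧
    N = fun δ => Uf.lim U fun M => M δ}, ?_, ?_, ?_⟩
  · rintro _ ⟨U, hU, rfl⟩
    exact IsUfNetwork.lim (N := fun M => M) (mem_of_superset hU hH.network)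
  · intro μ
    let P : μ.sets → Set ((Fin m → Fin n) → Uf A) := fun a =>
      {M | M ∈ H ∧ a.1 ∈ (M (Fin.castLE hmn)).sets}
    have : NeBot (⨅ a, 𝓟 (P a)) := by
      have : Nonempty μ.sets := ⟨⟨⊤, μ.top_mem⟩⟩
      refine iInf_neBot_of_directed' ?_ fun a => ?_
      · intro a b
        refine ⟨⟨a.1 ⊓ b.1, μ.inf_mem a.2 b.2⟩, ?_, ?_⟩
        · exact principal_mono.2 fun M hM => ⟨hM.1, (M _).up_closed hM.2 inf_le_left⟩
        · exact principal_mono.2 fun M hM => ⟨hM.1, (M _).up_closed hM.2 inf_le_right⟩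
      · rw [principal_neBot_iff]
        obtain ⟨N, hN, h⟩ := hH.start a.1 fun h0 => μ.bot_notMem (h0 ▸ a.2)
        exact ⟨N, hN, h⟩
    have hle : ∀ a, P a ∈ Ultrafilter.of (⨅ a, 𝓟 (P a)) := fun a =>
      Ultrafilter.of_le _ (mem_iInf_of_mem a (mem_principal_self _))
    refine ⟨_, ⟨Ultrafilter.of (⨅ a, 𝓟 (P a)), ?_, rfl⟩, ?_⟩
    · exact mem_of_superset (hle ⟨⊤, μ.top_mem⟩) fun M hM => hM.1
    · refine (Uf.eq_of_subset fun a ha => ?_).symm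
      exact mem_of_superset (hle ⟨a, ha⟩) fun M hM => hM.2
  · rintro _ ⟨U, hU, rfl⟩ x i μ hμ k hk
    -- The component `S ∈ U` ties the new networks to the old ones off `k`; this is what makes the
    -- two limits agree there.
    let P : {S : Set ((Fin m → Fin n) → Uf A) // S ∈ U} × μ.sets →
        Set ((Fin m → Fin n) → Uf A) := fun p =>
      {M | M ∈ H ∧ (∃ N ∈ p.1.1, ∀ y : Fin m → Fin n, (∀ j, y j ≠ k) → M y = N y) ∧
        p.2.1 ∈ (M (Function.update x i k)).sets}
    have : NeBot (⨅ p, 𝓟 (P p)) := by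
      have : Nonempty ({S : Set ((Fin m → Fin n) → Uf A) // S ∈ U} × μ.sets) :=
        ⟨⟨⟨_, univ_mem⟩, ⟨⊤, μ.top_mem⟩⟩⟩
      refine iInf_neBot_of_directed' ?_ fun p => ?_
      · intro p q
        refine ⟨⟨⟨p.1.1 ∩ q.1.1, inter_mem p.1.2 q.1.2⟩, ⟨p.2.1 ⊓ q.2.1, μ.inf_mem p.2.2 q.2.2⟩⟩,
          ?_, ?_⟩
        · refine principal_mono.2 ?_
          rintro M ⟨h1, ⟨N, hN, h2⟩, h3⟩
          exact ⟨h1, ⟨N, hN.1, h2⟩, (M _).up_closed h3 inf_le_left⟩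
        · refine principal_mono.2 ?_
          rintro M ⟨h1, ⟨N, hN, h2⟩, h3⟩
          exact ⟨h1, ⟨N, hN.2, h2⟩, (M _).up_closed h3 inf_le_right⟩
      · rw [principal_neBot_iff]
        have h1 : ∀ᶠ N : (Fin m → Fin n) → Uf A in U, A.cyl i p.2.1 ∈ (N x).sets := hμ _ p.2.2
        obtain ⟨N, hN1, hN2, hN3⟩ := (h1.and (Eventually.and hU p.1.2)).exists
        obtain ⟨M, hM, h2, h3⟩ := hH.witness N hN2 x i p.2.1 hN1 k hk
        exact ⟨M, hM, ⟨N, hN3, h2⟩, h3⟩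
    have hle : ∀ p, P p ∈ Ultrafilter.of (⨅ p, 𝓟 (P p)) := fun p =>
      Ultrafilter.of_le _ (mem_iInf_of_mem p (mem_principal_self _))
    refine ⟨_, ⟨Ultrafilter.of (⨅ p, 𝓟 (P p)), ?_, rfl⟩, fun y hy => ?_, ?_⟩
    · exact mem_of_superset (hle ⟨⟨_, univ_mem⟩, ⟨⊤, μ.top_mem⟩⟩) fun M hM => hM.1
    · refine (Uf.eq_of_subset fun b hb => ?_).symm
      -- The set `S` chosen here is that of all `N` with `b ∈ N y`.
      refine mem_of_superset (hle ⟨⟨_, hb⟩, ⟨⊤, μ.top_mem⟩⟩) ?_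
      rintro M ⟨-, ⟨N, hN, h2⟩, -⟩
      show b ∈ (M y).sets
      rw [h2 y hy]
      exact hN
    · refine (Uf.eq_of_subset fun a ha => ?_).symm
      exact mem_of_superset (hle ⟨⟨_, univ_mem⟩, ⟨a, ha⟩⟩) fun M hM => hM.2.2

/-- Keep the networks of `H` whose labels all come from ultrafilters of `B`. The initial networks
and witnesses required for `B` have one label of this form, and `label_induction` spreads it to all
labels. Exact ultrafilter witnesses matter: an initial label merely containing a given element could
fall outside the subframe. -/
theorem HasUfBasis.of_surjective (hA : A.IsCA) (h : A.HasUfBasis hmn)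
    {B : CylAlg.{v} m} {f : A → B} (hf : IsHom f) (surj : Function.Surjective f) :
    B.HasUfBasis hmn := by
  obtain ⟨H, hH⟩ := h
  have lift : ∀ N ∈ H, ∀ δ (μ : Uf B), N δ = Uf.comap hf μ →
      ∃ N' : (Fin m → Fin n) → Uf B, (fun δ => Uf.comap hf (N' δ)) = N := by
    intro N hN δ μ h
    have key : ∀ ε, ∃ ρ : Uf B, Uf.comap hf ρ = N ε := by
      refine (hH.network N hN).label_induction (p := fun ν => ∃ ρ : Uf B, Uf.comap hf ρ = ν)
        (δ := δ) ?_ ⟨μ, h.symm⟩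
      rintro i _ ν hν ⟨ρ, rfl⟩
      exact Uf.exists_comap_eq_of_rel hA hf surj hν
    choose N' hN' using key
    exact ⟨N', funext hN'⟩
  refine ⟨{N | (fun δ => Uf.comap hf (N δ)) ∈ H}, ?_, ?_, ?_⟩
  · exact fun N hN => (hH.network _ hN).of_comap hf surj
  · intro μ
    obtain ⟨N, hN, h⟩ := hH.start (Uf.comap hf μ)
    obtain ⟨N', rfl⟩ := lift N hN _ μ h
    exact ⟨N', hN, Uf.comap_injective hf surj h⟩
  · intro N hN x i μ hμ k hk
    obtain ⟨M, hM, h1, h2⟩ := hH.witness _ hN x i (Uf.comap hf μ) (hμ.comap hf) k hk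
    obtain ⟨M', rfl⟩ := lift M hM _ μ h2
    exact ⟨M', hM, fun y hy => Uf.comap_injective hf surj (h1 y hy),
      Uf.comap_injective hf surj h2⟩

theorem HasUfBasis.hasBasis_canExt (h : A.HasUfBasis hmn) : A.canExt.HasBasis hmn := by
  obtain ⟨H, hH⟩ := h
  have hatom : ∀ a : A.canExt, IsAtom a ↔ ∃ μ : Uf A, a = ({μ} : Set (Uf A)) := fun a =>
    Set.isAtom_iff (s := (show Set (Uf A) from a))
  have hle : ∀ (μ : Uf A) (X : Set (Uf A)),
      @LE.le A.canExt _ ({μ} : Set (Uf A)) X ↔ μ ∈ X := fun μ X => Set.singleton_subset_iff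
  refine ⟨{N' | ∃ N ∈ H, N' = fun δ => ({N δ} : Set (Uf A))}, ?_, ?_, ?_⟩
  · rintro _ ⟨N, hN, rfl⟩
    have hnet := hH.network N hN
    refine ⟨fun δ => (hatom _).2 ⟨_, rfl⟩, fun δ i j => ?_, fun δ i d => ?_, ?_⟩
    · exact (hle _ _).2 (hnet.diag δ i j)
    · exact (hle _ _).2 ⟨N δ, rfl, hnet.cyl δ i d⟩
    · intro δ i j h ε k hε
      exact congrArg _ (hnet.congr δ i j ((hle _ _).1 h) ε k hε)
  · intro a ha
    obtain ⟨μ, rfl⟩ := (hatom a).1 ha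
    obtain ⟨N, hN, h⟩ := hH.start μ
    exact ⟨_, ⟨N, hN, rfl⟩, congrArg _ h⟩
  · rintro _ ⟨N, hN, rfl⟩ x i a ha h k hk
    obtain ⟨μ, rfl⟩ := (hatom a).1 ha
    obtain ⟨ν, hν, hr⟩ := (hle _ _).1 h
    have hνμ : ν = μ := hν
    subst hνμ
    obtain ⟨N', hN', h1, h2⟩ := hH.witness N hN x i ν hr k hk
    exact ⟨_, ⟨N', hN', rfl⟩, fun y hy => congrArg _ (h1 y hy), congrArg _ h2⟩

theorem mem_CAB_of_hasBasis_canExt (hA : A.IsCA) (h : A.canExt.HasBasis hmn) :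
    A ∈ CAB hmn := by
  refine ⟨A.canExt, hA.canExt, fun S => ?_, ?_, h, embeds_canExt hA⟩
  · exact ⟨_, isLUB_sSup (α := Set (Uf A)) S⟩
  · exact inferInstanceAs (IsAtomic (Set (Uf A)))

/-- The complete atomic algebra in the definition of `CAB` can always be taken to be `A.canExt`. -/
theorem mem_CAB_iff : A ∈ CAB hmn ↔ A.IsCA ∧ A.HasWeakBasis hmn := by
  constructor
  · rintro ⟨B, hB, -, hat, hb, f, hf, inj⟩
    exact ⟨hB.of_injective hf inj, (hb.hasWeakBasis hB hat).comap hf inj⟩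
  · exact fun ⟨h1, h2⟩ => mem_CAB_of_hasBasis_canExt h1 h2.hasUfBasis.hasBasis_canExt

end Transfer

/-! ### From square representations to weak bases -/

section SquareToWeak

variable {m n : ℕ} {A : CylAlg.{u} m} {hmn : m ≤ n} {M : Type u} (R : RelRep A M)

namespace RelRep

theorem sat_top {s : Fin m → M} (h : s ∈ R.V) : R.Sat ⊤ s := by
  refine ⟨h, ?_⟩
  rw [R.isHom.map_top]
  exact Set.mem_univ _

theorem not_sat_bot (s : Fin m → M) : ¬ R.Sat ⊥ s := by
  rintro ⟨h, h1⟩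
  rw [R.isHom.map_bot] at h1
  exact h1

theorem Sat.mono {R : RelRep A M} {a b : A} {s : Fin m → M} (h : R.Sat a s) (hab : a ≤ b) :
    R.Sat b s :=
  ⟨h.1, (R.isHom.monotone hab : (show Set R.V from R.f a) ⊆ R.f b) h.2⟩

theorem Sat.inf {R : RelRep A M} {a b : A} {s : Fin m → M} (ha : R.Sat a s) (hb : R.Sat b s) :
    R.Sat (a ⊓ b) s := by
  refine ⟨ha.1, ?_⟩
  rw [R.isHom.map_inf]
  exact ⟨ha.2, hb.2⟩

theorem sat_or_sat_compl {s : Fin m → M} (h : s ∈ R.V) (a : A) : R.Sat a s ∨ R.Sat aᶜ s := by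
  by_cases ha : R.Sat a s
  · exact Or.inl ha
  · refine Or.inr ⟨h, ?_⟩
    rw [R.isHom.map_compl]
    exact fun h1 => ha ⟨h, h1⟩

theorem sat_cyl {i : Fin m} {a : A} {s : Fin m → M} :
    R.Sat (A.cyl i a) s ↔ s ∈ R.V ∧ ∃ t, R.Sat a t ∧ ∀ j, j ≠ i → t j = s j := by
  constructor
  · rintro ⟨h, h1⟩
    rw [R.isHom.map_cyl] at h1
    obtain ⟨t, ht, hts⟩ := h1
    exact ⟨h, t.1, ⟨t.2, ht⟩, hts⟩
  · rintro ⟨h, t, ⟨ht, h1⟩, hts⟩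
    refine ⟨h, ?_⟩
    rw [R.isHom.map_cyl]
    exact ⟨⟨t, ht⟩, h1, hts⟩

theorem sat_diag {i j : Fin m} {s : Fin m → M} :
    R.Sat (A.diag i j) s ↔ s ∈ R.V ∧ s i = s j := by
  constructor
  · rintro ⟨h, h1⟩
    rw [R.isHom.map_diag] at h1
    exact ⟨h, h1⟩
  · rintro ⟨h, h1⟩
    refine ⟨h, ?_⟩
    rw [R.isHom.map_diag]
    exact h1

theorem exists_sat {a : A} (ha : a ≠ ⊥) : ∃ s, R.Sat a s := by
  have h1 : R.f a ≠ ⊥ := fun h => ha (R.injective (h.trans R.isHom.map_bot.symm))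
  obtain ⟨s, hs⟩ := Set.nonempty_iff_ne_empty.2 h1
  exact ⟨s.1, s.2, hs⟩

/-- The unit is not assumed closed under substitutions, but `c_i d_ij = ⊤` supplies a tuple of `V`
that can only be this one. -/
theorem update_mem_V (hA : A.IsCA) {s : Fin m → M} (hs : s ∈ R.V) (i j : Fin m) :
    Function.update s i (s j) ∈ R.V := by
  by_cases hij : i = j
  · subst hij
    rwa [Function.update_eq_self]
  · have h1 : A.cyl i (A.diag i j) = ⊤ := by
      rw [← top_le_iff, ← hA.diag_self j, hA.diag_eq j j i hij hij]
      exact hA.cyl_mono i inf_le_right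
    obtain ⟨-, t, ht, hts⟩ := R.sat_cyl.1 (h1 ▸ R.sat_top hs)
    obtain ⟨htV, htij⟩ := R.sat_diag.1 ht
    convert htV using 1
    funext k
    by_cases hk : k = i
    · subst hk
      rw [Function.update_self, htij, hts j (Ne.symm hij)]
    · rw [Function.update_of_ne hk, hts k hk]

/-- The type of a tuple. -/
def uf {s : Fin m → M} (hs : s ∈ R.V) : Uf A where
  sets := {a | R.Sat a s}
  top_mem := R.sat_top hs
  bot_notMem := R.not_sat_bot s
  up_closed h hxy := Sat.mono h hxy
  inf_mem h h' := Sat.inf h h'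
  mem_or_compl_mem := R.sat_or_sat_compl hs

theorem uf_congr {s t : Fin m → M} (hs : s ∈ R.V) (ht : t ∈ R.V) (h : s = t) :
    R.uf hs = R.uf ht := by
  subst h; rfl

variable {R}

theorem comp_mem_V {s : Fin n → M} (hs : s ∈ R.cliqueTuples n) (δ : Fin m → Fin n) :
    s ∘ δ ∈ R.V :=
  hs _ fun j => Set.mem_range_self (δ j)

/-- The range of `s` need not be a clique, but that of a constant tuple in `V` is. Collapse the
coordinates of `s` onto the `0`-th one by one, cylindrifying `a` each time, and then use squareness
to undo the cylindrifications. The result satisfies `a` but need not be `s`. -/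
theorem IsSquare.exists_clique_sat (hA : A.IsCA) (hm : 0 < m) (hR : R.IsSquare n) (hmn : m ≤ n)
    {s : Fin m → M} {a : A} (h : R.Sat a s) :
    ∃ t ∈ R.cliqueTuples n, R.Sat a (t ∘ Fin.castLE hmn) := by
  -- `F` contains the coordinates that may still differ from the `0`-th.
  have key : ∀ F : Finset (Fin m), ∀ (a : A) (w : Fin m → M), R.Sat a w →
      (∀ j ∉ F, w j = w ⟨0, hm⟩) → ∃ t ∈ R.cliqueTuples n, R.Sat a (t ∘ Fin.castLE hmn) := by
    intro F
    induction F using Finset.induction_on with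
    | empty =>
      intro a w hw hF
      have hw' : w = fun _ => w ⟨0, hm⟩ := funext fun j => hF j (Finset.notMem_empty j)
      refine ⟨fun _ => w ⟨0, hm⟩, fun t ht => ?_, ?_⟩
      · have : t = w := by
          funext j
          obtain ⟨_, hk⟩ := ht j
          rw [hw', ← hk]
        rw [this]
        exact hw.1
      · rw [hw'] at hw
        exact hw
    | insert j F hj ih =>
      intro a w hw hF
      by_cases hj0 : j = ⟨0, hm⟩
      · refine ih a w hw fun k hk => ?_
        by_cases hkj : k = j
        · rw [hkj, hj0]
        · exact hF k (by simp [hk, hkj])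
      · obtain ⟨t, ht, h1⟩ := ih (A.cyl j a) (Function.update w j (w ⟨0, hm⟩))
          (R.sat_cyl.2 ⟨R.update_mem_V hA hw.1 j ⟨0, hm⟩, w, hw, fun k hk => by simp [hk]⟩)
          (fun k hk => by
            rw [Function.update_of_ne (Ne.symm hj0)]
            by_cases hkj : k = j
            · rw [hkj, Function.update_self]
            · rw [Function.update_of_ne hkj]
              exact hF k (by simp [hk, hkj]))
        obtain ⟨t', ht', -, h2⟩ := hR t ht a j (Fin.castLE hmn)
          (fun k hk h => hk (Fin.castLE_injective hmn h)) h1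
        exact ⟨t', ht', h2⟩
  exact key Finset.univ a s h fun j hj => absurd (Finset.mem_univ j) hj

theorem IsSquare.hasWeakBasis (hA : A.IsCA) (hm : 0 < m) (hR : R.IsSquare n) (hmn : m ≤ n) :
    A.HasWeakBasis hmn := by
  refine ⟨{N | ∃ s, ∃ hs : s ∈ R.cliqueTuples n, N = fun δ => R.uf (comp_mem_V hs δ)}, ?_, ?_, ?_⟩
  · rintro _ ⟨s, hs, rfl⟩
    refine ⟨fun δ i j => ?_, fun δ i d a ha => ?_, fun δ i j h ε k hε => ?_⟩
    · refine R.sat_diag.2 ⟨comp_mem_V hs _, ?_⟩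
      by_cases hij : j = i
      · rw [hij]
      · simp [hij]
    · exact R.sat_cyl.2 ⟨comp_mem_V hs _, s ∘ δ, ha, fun j hj => by simp [hj]⟩
    · have h' : s (δ i) = s (δ j) := (R.sat_diag.1 h).2
      apply R.uf_congr
      rw [Function.comp_update, ← h', ← hε]
      exact Function.update_eq_self k (s ∘ ε)
  · intro a ha
    obtain ⟨s, hs⟩ := R.exists_sat ha
    obtain ⟨t, ht, h⟩ := hR.exists_clique_sat hA hm hmn hs
    exact ⟨_, ⟨t, ht, rfl⟩, h⟩
  · rintro _ ⟨s, hs, rfl⟩ x i a h k hk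
    obtain ⟨-, r, hr, hrs⟩ := R.sat_cyl.1 h
    -- The truth of `c_i a` at a tuple of `V` ignores its `i`-th coordinate, so `x i` may first be
    -- replaced by `k`, the variable that squareness then changes.
    obtain ⟨t, ht, h1, h2⟩ := hR s hs a i (Function.update x i k)
      (fun j hj => by simpa [hj] using hk j hj)
      (R.sat_cyl.2 ⟨comp_mem_V hs _, r, hr, fun j hj => by simp [hj, hrs j hj]⟩)
    rw [Function.update_self] at h1
    exact ⟨_, ⟨t, ht, rfl⟩, fun y hy => R.uf_congr _ _ (funext fun j => h1 _ (hy j)), h2⟩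

end RelRep

end SquareToWeak

/-! ### Interchangeable nodes -/

section Interchange

variable {m n : ℕ} {B : CylAlg.{u} m}

/-- The nodes `k` and `k'` are interchangeable in the labelling `N`. -/
def Interchangeable {X β : Type*} (N : (Fin m → X) → β) (k k' : X) : Prop :=
  ∀ ε e, ε e = k → N (Function.update ε e k') = N ε

namespace Interchangeable

variable {X β : Type*} {N : (Fin m → X) → β} {k k' k'' : X}

theorem refl (N : (Fin m → X) → β) (k : X) : Interchangeable N k k := by
  rintro ε e rfl
  rw [Function.update_eq_self]

theorem symm (h : Interchangeable N k k') : Interchangeable N k' k := by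
  rintro ε e rfl
  rw [← h (Function.update ε e k) e (Function.update_self ..), Function.update_idem,
    Function.update_eq_self]

theorem trans (h : Interchangeable N k k') (h' : Interchangeable N k' k'') :
    Interchangeable N k k'' := by
  intro ε e hε
  rw [← h ε e hε, ← h' (Function.update ε e k') e (Function.update_self ..), Function.update_idem]

theorem label_eq {δ ε : Fin m → X} (h : ∀ l, Interchangeable N (δ l) (ε l)) : N δ = N ε := by
  have key : ∀ s : Finset (Fin m), N (s.piecewise ε δ) = N δ := by
    intro s
    induction s using Finset.induction_on with
    | empty => simp
    | insert j s hj ih =>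
      rw [Finset.piecewise_insert, ← ih]
      exact h j _ _ (by simp [hj])
  simpa using (key Finset.univ).symm

end Interchangeable

/-- Interchangeability, a condition on all labels, is thereby decided by one label. This lets it
play the role of equality of points. -/
theorem IsUfNetwork.interchangeable_iff {X : Type*} {N : (Fin m → X) → Uf B}
    (hN : IsUfNetwork B N) (δ : Fin m → X) (i j : Fin m) :
    Interchangeable N (δ i) (δ j) ↔ B.diag i j ∈ (N δ).sets := by
  refine ⟨fun h => ?_, fun h => hN.congr δ i j h⟩
  rw [← h δ i rfl]
  exact hN.diag δ i j

theorem IsNetwork.interchangeable_iff {N : (Fin m → Fin n) → B} (hN : IsNetwork B n N)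
    (δ : Fin m → Fin n) (i j : Fin m) :
    Interchangeable N (δ i) (δ j) ↔ N δ ≤ B.diag i j := by
  refine ⟨fun h => ?_, fun h => hN.congr δ i j h⟩
  rw [← h δ i rfl]
  exact hN.diag δ i j

/-- Whether two nodes are interchangeable depends only on the tuples through these nodes. -/
theorem IsNetwork.interchangeable_iff_of_agree (hm : 1 < m) {N N' : (Fin m → Fin n) → B}
    (hN : IsNetwork B n N) (hN' : IsNetwork B n N') {k j j' : Fin n}
    (h : ∀ y : Fin m → Fin n, (∀ l, y l ≠ k) → N' y = N y) (hj : j ≠ k) (hj' : j' ≠ k) :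
    Interchangeable N' j j' ↔ Interchangeable N j j' := by
  let δ : Fin m → Fin n := fun l => if l = ⟨0, by omega⟩ then j else j'
  have h0 : δ ⟨0, by omega⟩ = j := if_pos rfl
  have h1 : δ ⟨1, hm⟩ = j' := if_neg (by simp)
  have hδ : N' δ = N δ := h δ fun l => by
    by_cases hl : l = ⟨0, by omega⟩
    · rwa [hl, h0]
    · rwa [show δ l = j' from if_neg hl]
  rw [← h0, ← h1, hN.interchangeable_iff, hN'.interchangeable_iff, hδ]

end Interchange

/-! ### An unravelling yields a square representation -/

section Unravelling

variable {m n : ℕ} {B : CylAlg.{u} m}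

/-- A set `M` covered by bags, each of them being an image of the nodes of a network of the
basis `H`. -/
structure Unravelling (B : CylAlg.{u} m) (H : Set ((Fin m → Fin n) → B)) (P M : Type u) where
  label : P → (Fin m → Fin n) → B
  val : P → Fin n → M
  label_mem : ∀ p, label p ∈ H
  exists_label : ∀ N ∈ H, ∃ p, label p = N
  val_eq_iff : ∀ p j j', val p j = val p j' ↔ Interchangeable (label p) j j'
  label_eq : ∀ p q δ ε, (∀ l, val p (δ l) = val q (ε l)) → label p δ = label q ε
  extend : ∀ p k, ∀ N ∈ H, (∀ y : Fin m → Fin n, (∀ l, y l ≠ k) → N y = label p y) →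
    ∃ q, label q = N ∧ ∀ j, j ≠ k → val q j = val p j
  bag : ∀ s : Fin n → M, (∀ j j', ∃ p, s j ∈ Set.range (val p) ∧ s j' ∈ Set.range (val p)) →
    ∃ p, ∀ j, s j ∈ Set.range (val p)
  cover : ∀ x, ∃ p, x ∈ Set.range (val p)

/-- Pigeonhole: `n - 1` values do not exhaust `n` nodes, so a node can always be freed for a
witness. -/
theorem exists_ne_of_forall_ne {n : ℕ} (i : Fin n) (f : Fin n → Fin n) :
    ∃ k, ∀ j, j ≠ i → f j ≠ k := by
  by_contra hn
  push Not at hn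
  have h1 : (Finset.univ : Finset (Fin n)) ⊆ (Finset.univ.erase i).image f := by
    intro k _
    obtain ⟨j, hj, hk⟩ := hn k
    exact Finset.mem_image.2 ⟨j, by simp [hj], hk⟩
  have h2 := (Finset.card_le_card h1).trans Finset.card_image_le
  rw [Finset.card_erase_of_mem (Finset.mem_univ i)] at h2
  have h3 : 0 < (Finset.univ : Finset (Fin n)).card := Finset.card_pos.2 ⟨i, Finset.mem_univ i⟩
  omega

theorem exists_ne_of_forall_ne' {m n : ℕ} (hmn : m ≤ n) (i : Fin m) (f : Fin m → Fin n) :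
    ∃ k, ∀ j, j ≠ i → f j ≠ k := by
  obtain ⟨k, hk⟩ := exists_ne_of_forall_ne (Fin.castLE hmn i)
    (fun j : Fin n => if h : j.1 < m then f ⟨j.1, h⟩ else f i)
  refine ⟨k, fun j hj => ?_⟩
  have := hk (Fin.castLE hmn j) (fun h => hj (Fin.castLE_injective hmn h))
  simpa using this

variable {H : Set ((Fin m → Fin n) → B)} {P M : Type u}

namespace Unravelling

variable (T : Unravelling B H P M)

/-- The tuples that lie in a single bag. -/
def V : Set (Fin m → M) := {s | ∃ (p : P) (δ : Fin m → Fin n), ∀ l, s l = T.val p (δ l)}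

/-- The set of tuples whose label lies below `b`. -/
def below (b : B) : Set T.V :=
  {s | ∃ (p : P) (δ : Fin m → Fin n), (∀ l, s.1 l = T.val p (δ l)) ∧ T.label p δ ≤ b}

theorem comp_mem_V (p : P) (δ : Fin m → Fin n) : T.val p ∘ δ ∈ T.V := ⟨p, δ, fun _ => rfl⟩

theorem mem_below {b : B} {s : T.V} {p : P} {δ : Fin m → Fin n}
    (h : ∀ l, s.1 l = T.val p (δ l)) : s ∈ T.below b ↔ T.label p δ ≤ b := by
  refine ⟨?_, fun hb => ⟨p, δ, h, hb⟩⟩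
  rintro ⟨q, ε, h1, h2⟩
  rwa [T.label_eq p q δ ε fun l => (h l).symm.trans (h1 l)]

theorem isHom_below {hmn : m ≤ n} (hm : 1 < m) (hB : B.IsCA) (hat : IsAtomic B)
    (hH : IsBasis B hmn H) : IsHom (A := B) (B := relSetAlg T.V) T.below where
  map_bot := Set.eq_empty_of_forall_notMem fun s ⟨p, δ, _, h⟩ =>
    ((hH.network _ (T.label_mem p)).atom δ).1 (le_bot_iff.1 h)
  map_top := Set.eq_univ_of_forall fun s => by
    obtain ⟨p, δ, h⟩ := s.2
    exact ⟨p, δ, h, le_top⟩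
  map_sup x y := Set.ext fun s => by
    obtain ⟨p, δ, h⟩ := s.2
    have ha := (hH.network _ (T.label_mem p)).atom δ
    show s ∈ T.below (x ⊔ y) ↔ s ∈ T.below x ∨ s ∈ T.below y
    rw [T.mem_below h, T.mem_below h, T.mem_below h]
    exact (Uf.ofAtom ha).sup_mem_iff x y
  map_inf x y := Set.ext fun s => by
    obtain ⟨p, δ, h⟩ := s.2
    show s ∈ T.below (x ⊓ y) ↔ s ∈ T.below x ∧ s ∈ T.below y
    rw [T.mem_below h, T.mem_below h, T.mem_below h, le_inf_iff]
  map_compl x := Set.ext fun s => by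
    obtain ⟨p, δ, h⟩ := s.2
    have ha := (hH.network _ (T.label_mem p)).atom δ
    show s ∈ T.below xᶜ ↔ s ∉ T.below x
    rw [T.mem_below h, T.mem_below h]
    exact (Uf.ofAtom ha).compl_mem_iff x
  map_diag i j := Set.ext fun s => by
    obtain ⟨p, δ, h⟩ := s.2
    show s ∈ T.below (B.diag i j) ↔ s.1 i = s.1 j
    rw [T.mem_below h, h i, h j, T.val_eq_iff,
      (hH.network _ (T.label_mem p)).interchangeable_iff]
  map_cyl i x := Set.ext fun s => by
    obtain ⟨p, δ, h⟩ := s.2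
    have hp := hH.network _ (T.label_mem p)
    show s ∈ T.below (B.cyl i x) ↔ ∃ t ∈ T.below x, ∀ j, j ≠ i → t.1 j = s.1 j
    rw [T.mem_below h]
    constructor
    · intro hx
      obtain ⟨b, hb, hbx, hle⟩ := hB.exists_atom_le i (hp.atom δ) hx
      obtain ⟨k, hk⟩ := exists_ne_of_forall_ne' hmn i δ
      obtain ⟨N, hN, h1, h2⟩ := hH.witness _ (T.label_mem p) δ i b hb hle k hk
      obtain ⟨q, rfl, hq⟩ := T.extend p k N hN h1
      refine ⟨⟨_, T.comp_mem_V q (Function.update δ i k)⟩,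
        ⟨q, _, fun _ => rfl, h2.trans_le hbx⟩, fun j hj => ?_⟩
      show T.val q (Function.update δ i k j) = s.1 j
      rw [Function.update_of_ne hj, hq _ (hk j hj), h j]
    · rintro ⟨t, ⟨q, ε, h1, h2⟩, hts⟩
      have hq := hH.network _ (T.label_mem q)
      obtain ⟨j, hj⟩ : ∃ j : Fin m, j ≠ i := by
        have : Nontrivial (Fin m) := Fin.nontrivial_iff_two_le.2 hm
        exact exists_ne i
      -- The two tuples differ only at `i`; overwriting that place by the `j`-th entry makes them
      -- the same tuple of points, with one common label. The label of `s` lies below `c_i` of it,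
      -- and it lies below `c_i` of the label of `t`.
      have e : T.label p (Function.update δ i (δ j)) = T.label q (Function.update ε i (ε j)) := by
        apply T.label_eq
        intro l
        by_cases hl : l = i
        · subst hl
          rw [Function.update_self, Function.update_self, ← h j, ← h1 j, hts j hj]
        · rw [Function.update_of_ne hl, Function.update_of_ne hl, ← h l, ← h1 l, hts l hl]
      have e1 := hB.atom_le_cyl_symm i (hp.atom _) (hp.atom _) (hp.cyl δ i (δ j))
      have e2 := hq.cyl ε i (ε j)
      rw [← e] at e2
      have e3 := e1.trans (hB.cyl_mono i e2)
      rw [hB.cyl_cyl] at e3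
      exact e3.trans (hB.cyl_mono i h2)

/-- The relativized representation of a subalgebra given by an unravelling. -/
def relRep {A : CylAlg.{u} m} {hmn : m ≤ n} (hm : 1 < m) (hB : B.IsCA) (hat : IsAtomic B)
    (hH : IsBasis B hmn H) [hM : Nonempty M] {f : A → B} (hf : IsHom f)
    (inj : Function.Injective f) : RelRep A M where
  nonempty := hM
  V := T.V
  f a := T.below (f a)
  isHom := (T.isHom_below hm hB hat hH).comp hf
  injective := by
    refine fun x y h => inj ((T.isHom_below hm hB hat hH).injective_of_ne_bot ?_ h)
    intro b hb h0
    obtain ⟨a, ha, hab⟩ := (hat.eq_bot_or_exists_atom_le b).resolve_left hb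
    obtain ⟨N, hN, h1⟩ := hH.atom a ha
    obtain ⟨p, rfl⟩ := T.exists_label N hN
    have h2 : (⟨_, T.comp_mem_V p (Fin.castLE hmn)⟩ : T.V) ∈ T.below b :=
      ⟨p, _, fun _ => rfl, h1.trans_le hab⟩
    rw [show T.below b = (∅ : Set T.V) from h0] at h2
    exact h2
  cover x := by
    obtain ⟨p, k, rfl⟩ := T.cover x
    exact ⟨_, T.comp_mem_V p fun _ => k, ⟨0, by omega⟩, rfl⟩

/-- Any two points of a clique share a bag, so the Helly property `bag` puts the whole clique tuple
into one bag. Squareness is then the witness property of the network there. -/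
theorem isSquare_relRep {A : CylAlg.{u} m} {hmn : m ≤ n} (hm : 1 < m) (hB : B.IsCA)
    (hat : IsAtomic B) (hH : IsBasis B hmn H) [hM : Nonempty M] {f : A → B} (hf : IsHom f)
    (inj : Function.Injective f) : (T.relRep hm hB hat hH hf inj).IsSquare n := by
  intro s hs a i l hl hsat
  obtain ⟨p, hp⟩ : ∃ p, ∀ j, s j ∈ Set.range (T.val p) := by
    refine T.bag s fun j j' => ?_
    obtain ⟨p, δ, h⟩ := hs (fun l : Fin m => if l = ⟨0, by omega⟩ then s j else s j') (fun l => by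
      by_cases h : l = ⟨0, by omega⟩
      · rw [if_pos h]; exact Set.mem_range_self j
      · rw [if_neg h]; exact Set.mem_range_self j')
    refine ⟨p, ⟨δ ⟨0, by omega⟩, ?_⟩, ⟨δ ⟨1, hm⟩, ?_⟩⟩
    · simpa using (h ⟨0, by omega⟩).symm
    · simpa using (h ⟨1, hm⟩).symm
  choose τ hτ using hp
  obtain ⟨hV, hmem⟩ := hsat
  have hle : T.label p (τ ∘ l) ≤ B.cyl i (f a) := by
    rw [← hf.map_cyl]
    exact (T.mem_below (s := ⟨s ∘ l, hV⟩) fun j => (hτ (l j)).symm).1 hmem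
  obtain ⟨b, hb, hba, hLb⟩ := hB.exists_atom_le i ((hH.network _ (T.label_mem p)).atom _) hle
  -- Several nodes may name the same point; only those chosen by `τ` for the variables other than `l
  -- i` have to survive.
  obtain ⟨k, hk⟩ := exists_ne_of_forall_ne (l i) τ
  obtain ⟨N, hN, h1, h2⟩ := hH.witness _ (T.label_mem p) (τ ∘ l) i b hb hLb k
    (fun j hj => hk _ (hl j hj))
  obtain ⟨q, rfl, hq⟩ := T.extend p k N hN h1
  have hτl : Function.update τ (l i) k ∘ l = Function.update (τ ∘ l) i k := by
    funext j
    by_cases hj : j = i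
    · subst hj; simp
    · simp [hj, hl j hj]
  refine ⟨T.val q ∘ Function.update τ (l i) k, ?_, ?_, ?_⟩
  · intro t ht
    choose δ hδ using ht
    exact ⟨q, _, fun j => (hδ j).symm⟩
  · intro j hj
    rw [Function.comp_apply, Function.update_of_ne hj, hq _ (hk j hj), hτ]
  · rw [Function.comp_assoc, hτl]
    exact ⟨T.comp_mem_V q _, q, _, fun _ => rfl, h2.trans_le hba⟩

end Unravelling

end Unravelling

/-! ### The unravelling by finite paths -/

section Paths

variable {m n : ℕ} {B : CylAlg.{u} m}

/-- Finite sequences of labellings, each but the first marked with a node. -/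
inductive Path (X : Type u) (n : ℕ) : Type u
  | root (N : X)
  | step (p : Path X n) (k : Fin n) (N : X)

namespace Path

def label {X : Type u} : Path X n → X
  | root N => N
  | step _ _ N => N

def depth {X : Type u} : Path X n → ℕ
  | root _ => 0
  | step p _ _ => p.depth + 1

/-- The labellings of the path belong to `H` and consecutive ones agree off the marked node. -/
def Valid (H : Set ((Fin m → Fin n) → B)) : Path ((Fin m → Fin n) → B) n → Prop
  | root N => N ∈ H
  | step p k N => p.Valid H ∧ N ∈ H ∧ ∀ y : Fin m → Fin n, (∀ l, y l ≠ k) → N y = p.label y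

open Classical in
/-- The points named by the nodes at the end of a path. A node that is interchangeable with an
older one names the same point, other new nodes name a new point. -/
noncomputable def val : Path ((Fin m → Fin n) → B) n → Fin n → Path ((Fin m → Fin n) → B) n × Fin n
  | root N => fun k => (root N, @Classical.epsilon _ ⟨k⟩ (Interchangeable N k))
  | step p k N => fun j =>
    if j ≠ k then p.val j
    else if h : ∃ j', j' ≠ k ∧ Interchangeable N k j' then p.val h.choose
    else (step p k N, k)

variable {H : Set ((Fin m → Fin n) → B)} {hmn : m ≤ n}

theorem Valid.label_mem {p : Path ((Fin m → Fin n) → B) n} (hp : p.Valid H) : p.label ∈ H := by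
  cases p with
  | root N => exact hp
  | step p k N => exact hp.2.1

theorem val_step_of_ne {p : Path ((Fin m → Fin n) → B) n} {k j : Fin n}
    {N : (Fin m → Fin n) → B} (h : j ≠ k) : (step p k N).val j = p.val j := by
  simp [val, h]

theorem val_step_cases (p : Path ((Fin m → Fin n) → B) n) (k j : Fin n)
    (N : (Fin m → Fin n) → B) :
    (∃ j', j' ≠ k ∧ Interchangeable N j j' ∧ (step p k N).val j = p.val j') ∨
      (j = k ∧ (¬ ∃ j', j' ≠ k ∧ Interchangeable N k j') ∧
        (step p k N).val j = (step p k N, k)) := by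
  by_cases hj : j = k
  · subst hj
    by_cases h : ∃ j', j' ≠ j ∧ Interchangeable N j j'
    · exact Or.inl ⟨h.choose, h.choose_spec.1, h.choose_spec.2, by simp only [val]; simp [h]⟩
    · exact Or.inr ⟨rfl, h, by simp only [val]; simp [h]⟩
  · exact Or.inl ⟨j, hj, Interchangeable.refl N j, val_step_of_ne hj⟩

/-- Points are named after the place where they first occur. -/
theorem birth (p : Path ((Fin m → Fin n) → B) n) (j : Fin n) :
    (p.val j).1 = p ∨ (p.val j).1.depth < p.depth := by
  induction p generalizing j with
  | root N => exact Or.inl rfl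
  | step p k N ih =>
    rcases val_step_cases p k j N with ⟨j', -, -, h⟩ | ⟨-, -, h⟩
    · rw [h]
      right
      rcases ih j' with h1 | h1
      · rw [h1]; exact Nat.lt_succ_self _
      · exact h1.trans (Nat.lt_succ_self _)
    · exact Or.inl (by rw [h])

theorem birth_ne_step (p : Path ((Fin m → Fin n) → B) n) (j k : Fin n)
    (N : (Fin m → Fin n) → B) : (p.val j).1 ≠ step p k N := by
  intro h
  rcases birth p j with h1 | h1
  · rw [h] at h1
    have := congrArg depth h1
    simp [depth] at this
  · rw [h] at h1
    simp [depth] at h1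

theorem valid_birth {p : Path ((Fin m → Fin n) → B) n} (hp : p.Valid H) (j : Fin n) :
    (p.val j).1.Valid H := by
  induction p generalizing j with
  | root N => exact hp
  | step p k N ih =>
    rcases val_step_cases p k j N with ⟨j', -, -, h⟩ | ⟨-, -, h⟩
    · rw [h]; exact ih hp.1 j'
    · rw [h]; exact hp

theorem exists_val_eq {p : Path ((Fin m → Fin n) → B) n} {k j : Fin n}
    {N : (Fin m → Fin n) → B} (h : ((step p k N).val j).1 ≠ step p k N) :
    ∃ j', j' ≠ k ∧ Interchangeable N j j' ∧ (step p k N).val j = p.val j' := by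
  rcases val_step_cases p k j N with h1 | ⟨-, -, h1⟩
  · exact h1
  · exact absurd (by rw [h1]) h

/-- For nodes kept in a step, both sides pass between the path and its predecessor, because
interchangeability depends only on labels off the marked node. The marked node either copies an
older interchangeable one or names a point that occurs nowhere before. -/
theorem val_eq_iff (hm : 1 < m) (hH : IsBasis B hmn H) {p : Path ((Fin m → Fin n) → B) n}
    (hp : p.Valid H) (j j' : Fin n) : p.val j = p.val j' ↔ Interchangeable p.label j j' := by
  induction p generalizing j j' with
  | root N =>
    show (root N, _) = (root N, _) ↔ Interchangeable N j j'
    have hs : ∀ k, Interchangeable N k (@Classical.epsilon _ ⟨k⟩ (Interchangeable N k)) :=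
      fun k => Classical.epsilon_spec (p := Interchangeable N k) ⟨k, Interchangeable.refl N k⟩
    constructor
    · intro h
      have h1 := (Prod.ext_iff.1 h).2
      have h2 := hs j
      simp only at h1
      rw [h1] at h2
      exact h2.trans (hs j').symm
    · intro h
      -- Equal predicates have the same chosen representative.
      have : Interchangeable N j = Interchangeable N j' :=
        funext fun k => propext ⟨fun h1 => h.symm.trans h1, fun h1 => h.trans h1⟩
      rw [this]
  | step p k N ih =>
    obtain ⟨hp, hN, hag⟩ := hp
    have hNn := hH.network N hN
    have hpn := hH.network _ hp.label_mem
    have tr : ∀ {i i'}, i ≠ k → i' ≠ k →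
        (p.val i = p.val i' ↔ Interchangeable N i i') := fun hi hi' =>
      (ih hp _ _).trans (hpn.interchangeable_iff_of_agree hm hNn hag hi hi').symm
    show _ ↔ Interchangeable N j j'
    rcases val_step_cases p k j N with ⟨i, hi, h1, h2⟩ | ⟨rfl, h1, h2⟩ <;>
      rcases val_step_cases p _ j' N with ⟨i', hi', h3, h4⟩ | ⟨h5, h3, h4⟩
    · rw [h2, h4, tr hi hi']
      exact ⟨fun h => (h1.trans h).trans h3.symm, fun h => (h1.symm.trans h).trans h3⟩
    · subst h5
      rw [h2, h4]
      refine ⟨fun h => absurd (congrArg Prod.fst h) (birth_ne_step _ _ _ _), fun h => ?_⟩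
      exact absurd ⟨i, hi, h.symm.trans h1⟩ h3
    · rw [h2, h4]
      refine ⟨fun h => absurd (congrArg Prod.fst h).symm (birth_ne_step _ _ _ _), fun h => ?_⟩
      exact absurd ⟨i', hi', h.trans h3⟩ h1
    · subst h5
      exact ⟨fun _ => Interchangeable.refl N _, fun _ => rfl⟩

/-- The label of a tuple of points does not depend on the path. -/
theorem label_eq (hm : 1 < m) (hH : IsBasis B hmn H) {p q : Path ((Fin m → Fin n) → B) n}
    (hp : p.Valid H) (hq : q.Valid H) {δ ε : Fin m → Fin n}
    (h : ∀ l, p.val (δ l) = q.val (ε l)) : p.label δ = q.label ε := by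
  obtain ⟨d, hd⟩ : ∃ d, p.depth + q.depth = d := ⟨_, rfl⟩
  induction d using Nat.strong_induction_on generalizing p q δ ε with
  | _ d ih =>
    have key : ∀ {p q : Path ((Fin m → Fin n) → B) n} {δ ε : Fin m → Fin n}, p.Valid H →
        q.Valid H → (∀ l, p.val (δ l) = q.val (ε l)) → p.depth + q.depth = d →
        q.depth ≤ p.depth → p.label δ = q.label ε := by
      intro p q δ ε hp hq h hd hle
      by_cases hpq : p = q
      · subst hpq
        exact Interchangeable.label_eq fun l => (val_eq_iff hm hH hp _ _).1 (h l)
      -- A point born at `p` could occur at the different path `q` only if `q` were strictly deeper.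
      -- So all points of the tuple are older than `p` and can be named at its predecessor.
      have hne : ∀ l, (p.val (δ l)).1 ≠ p := by
        intro l hl
        rw [h l] at hl
        rcases birth q (ε l) with h1 | h1
        · exact hpq (hl.symm.trans h1)
        · rw [hl] at h1
          omega
      cases p with
      | root N => exact absurd rfl (hne ⟨0, by omega⟩)
      | step p k N =>
        choose δ' h1 h2 h3 using fun l => exists_val_eq (hne l)
        have e1 : N δ = p.label δ' :=
          (Interchangeable.label_eq h2).trans (hp.2.2 δ' h1)
        refine e1.trans (ih (p.depth + q.depth) ?_ hp.1 hq (fun l => ?_) rfl)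
        · rw [← hd]
          simp [depth]
        · rw [← h3, h]
    rcases le_total q.depth p.depth with hle | hle
    · exact key hp hq h hd hle
    · exact (key hq hp (fun l => (h l).symm) (by omega) hle).symm

/-- The points that occur together with `x` and are not younger than `x` occur at the birth
of `x`. -/
theorem mem_range_birth {p : Path ((Fin m → Fin n) → B) n}
    {x y : Path ((Fin m → Fin n) → B) n × Fin n} (hx : x ∈ Set.range p.val)
    (hy : y ∈ Set.range p.val) (hxy : y.1.depth ≤ x.1.depth) : y ∈ Set.range x.1.val := by
  induction p with
  | root N =>
    obtain ⟨j, rfl⟩ := hx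
    exact hy
  | step p k N ih =>
    by_cases hxp : x.1 = step p k N
    · rwa [hxp]
    obtain ⟨j, rfl⟩ := hx
    obtain ⟨j', rfl⟩ := hy
    have hlt := (birth (step p k N) j).resolve_left hxp
    have hyp : ((step p k N).val j').1 ≠ step p k N := by
      intro h
      rw [h] at hxy
      omega
    obtain ⟨i, -, -, h1⟩ := exists_val_eq hxp
    obtain ⟨i', -, -, h2⟩ := exists_val_eq hyp
    exact ih ⟨i, h1.symm⟩ ⟨i', h2.symm⟩

/-- The valid paths form an unravelling. -/
noncomputable def unravelling (hm : 1 < m) (hH : IsBasis B hmn H) :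
    Unravelling B H {p : Path ((Fin m → Fin n) → B) n // p.Valid H}
      {x : Path ((Fin m → Fin n) → B) n × Fin n // ∃ p : Path ((Fin m → Fin n) → B) n,
        p.Valid H ∧ x ∈ Set.range p.val} where
  label p := p.1.label
  val p j := ⟨p.1.val j, p.1, p.2, j, rfl⟩
  label_mem p := p.2.label_mem
  exists_label N hN := ⟨⟨root N, hN⟩, rfl⟩
  val_eq_iff p j j' := by
    rw [Subtype.mk.injEq]
    exact val_eq_iff hm hH p.2 j j'
  label_eq p q δ ε h := label_eq hm hH p.2 q.2 fun l => congrArg Subtype.val (h l)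
  extend p k N hN h :=
    ⟨⟨step p.1 k N, p.2, hN, h⟩, rfl, fun j hj => Subtype.ext (val_step_of_ne hj)⟩
  bag s h := by
    have : Nonempty (Fin n) := ⟨⟨0, by omega⟩⟩
    -- The common bag is the birthplace of a youngest point: each other point shares a bag with it
    -- and is not younger.
    obtain ⟨j, hj⟩ := Finite.exists_max fun j => (s j).1.1.depth
    obtain ⟨⟨p, hp⟩, ⟨i, hi⟩, -⟩ := h j j
    have hi' : p.val i = (s j).1 := congrArg Subtype.val hi
    refine ⟨⟨(s j).1.1, hi' ▸ valid_birth hp i⟩, fun j' => ?_⟩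
    obtain ⟨⟨q, hq⟩, ⟨i1, h1⟩, ⟨i2, h2⟩⟩ := h j j'
    obtain ⟨i3, h3⟩ := mem_range_birth (p := q) ⟨i1, congrArg Subtype.val h1⟩
      ⟨i2, congrArg Subtype.val h2⟩ (hj j')
    exact ⟨i3, Subtype.ext h3⟩
  cover x := by
    obtain ⟨p, hp, j, hj⟩ := x.2
    exact ⟨⟨p, hp⟩, j, Subtype.ext hj⟩

end Path

theorem hasSquareRep_of_mem_CAB {hmn : m ≤ n} (hm : 1 < m) {A : CylAlg.{u} m} [Nontrivial A]
    (hA : A ∈ CAB hmn) : A.HasSquareRep n := by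
  obtain ⟨B, hB, -, hat, ⟨H, hH⟩, f, hf, inj⟩ := hA
  have hne : (⊤ : B) ≠ ⊥ := by
    rw [← hf.map_top, ← hf.map_bot]
    exact fun h => top_ne_bot (inj h)
  obtain ⟨a, ha, -⟩ := (hat.eq_bot_or_exists_atom_le (⊤ : B)).resolve_left hne
  obtain ⟨N, hN, -⟩ := hH.atom a ha
  let T := Path.unravelling hm hH
  obtain ⟨p, -⟩ := T.exists_label N hN
  have : Nonempty {x : Path ((Fin m → Fin n) → B) n × Fin n //
      ∃ p : Path ((Fin m → Fin n) → B) n, p.Valid H ∧ x ∈ Set.range p.val} :=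
    ⟨T.val p ⟨0, by omega⟩⟩
  exact ⟨_, T.relRep hm hB hat hH hf inj, T.isSquare_relRep hm hB hat hH hf inj⟩

end Paths

/-! ### Networks with witnesses for all cylindrifications -/

section Henkin

/-- Nodes of the network to be built: an initial tuple, and a witness node for each
cylindrification at each tuple. -/
inductive Henkin {m : ℕ} (A : CylAlg.{u} m) : Type u
  | base (j : Fin m)
  | wit (i : Fin m) (a : A) (δ : Fin m → Henkin A)

namespace Henkin

variable {m : ℕ} {A : CylAlg.{u} m}

open Classical in
/-- Finite sets of nodes that contain the initial nodes and are closed under subterms. -/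
inductive Closed : Finset (Henkin A) → Prop
  | base : Closed (Finset.univ.image base)
  | insert (F : Finset (Henkin A)) (i : Fin m) (a : A) (δ : Fin m → Henkin A) :
    Closed F → (∀ j, δ j ∈ F) → Closed (insert (wit i a δ) F)

namespace Closed

theorem base_mem {F : Finset (Henkin A)} (hF : Closed F) (j : Fin m) : Henkin.base j ∈ F := by
  classical
  induction hF with
  | base => simp
  | insert F i a δ hF hδ ih => simp [ih]

theorem mem_of_wit_mem {F : Finset (Henkin A)} (hF : Closed F) {i : Fin m} {a : A}
    {δ : Fin m → Henkin A} (h : wit i a δ ∈ F) (j : Fin m) : δ j ∈ F := by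
  classical
  induction hF with
  | base => simp at h
  | insert F i' a' δ' hF hδ ih =>
    rcases Finset.mem_insert.1 h with h1 | h1
    · cases h1
      exact Finset.mem_insert_of_mem (hδ j)
    · exact Finset.mem_insert_of_mem (ih h1)

open Classical in
theorem union {F G : Finset (Henkin A)} (hF : Closed F) (hG : Closed G) : Closed (F ∪ G) := by
  induction hG with
  | base =>
    rw [Finset.union_eq_left.2]
    · exact hF
    · intro w hw
      obtain ⟨j, -, rfl⟩ := Finset.mem_image.1 hw
      exact hF.base_mem j
  | insert G i a δ hG hδ ih =>
    rw [Finset.union_insert]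
    exact Closed.insert _ i a δ ih fun j => Finset.mem_union_right _ (hδ j)

theorem exists_of_forall {ι : Type*} (s : Finset ι) (g : ι → Henkin A)
    (h : ∀ j ∈ s, ∃ F, Closed F ∧ g j ∈ F) : ∃ F, Closed F ∧ ∀ j ∈ s, g j ∈ F := by
  classical
  induction s using Finset.induction_on with
  | empty => exact ⟨_, Closed.base, by simp⟩
  | insert j s hj ih =>
    obtain ⟨F, hF, h1⟩ := ih fun l hl => h l (Finset.mem_insert_of_mem hl)
    obtain ⟨G, hG, h2⟩ := h j (Finset.mem_insert_self j s)
    refine ⟨F ∪ G, hF.union hG, fun l hl => ?_⟩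
    rcases Finset.mem_insert.1 hl with rfl | hl
    · exact Finset.mem_union_right _ h2
    · exact Finset.mem_union_left _ (h1 l hl)

theorem exists_mem (w : Henkin A) : ∃ F, Closed F ∧ w ∈ F := by
  classical
  induction w with
  | base j => exact ⟨_, Closed.base, by simp⟩
  | wit i a δ ih =>
    obtain ⟨F, hF, h⟩ := exists_of_forall Finset.univ δ fun j _ => ih j
    exact ⟨_, Closed.insert F i a δ hF fun j => h j (Finset.mem_univ j),
      Finset.mem_insert_self _ _⟩

theorem exists_superset (G : Finset (Henkin A)) : ∃ F, Closed F ∧ G ⊆ F :=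
  exists_of_forall G id fun w _ => exists_mem w

end Closed

/-- Build the network along the construction of `F`, giving each new witness term a node not used so
far. Since `F` has at most `k` elements such a node exists, and no earlier label is disturbed. -/
theorem exists_network_fin {k : ℕ} {hk : m ≤ k} (hm : 0 < m)
    {H : Set ((Fin m → Fin k) → Uf A)} (hH : IsWeakBasis A hk H) {a₀ : A} (ha₀ : a₀ ≠ ⊥)
    {F : Finset (Henkin A)} (hF : Closed F) (hFk : F.card ≤ k) :
    ∃ N ∈ H, ∃ e : Henkin A → Fin k, a₀ ∈ (N (e ∘ base)).sets ∧
      ∀ i a δ, wit i a δ ∈ F → A.cyl i a ∈ (N (e ∘ δ)).sets →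
        a ∈ (N (e ∘ Function.update δ i (wit i a δ))).sets := by
  classical
  induction hF with
  | base =>
    obtain ⟨N, hN, h⟩ := hH.start a₀ ha₀
    refine ⟨N, hN, fun w => match w with
      | base j => Fin.castLE hk j
      -- A dummy value: witness terms outside the closed set are unconstrained.
      | wit _ _ _ => ⟨0, by omega⟩, h, ?_⟩
    intro i a δ h
    simp at h
  | insert F i a δ hF hδ ih =>
    by_cases hmem : wit i a δ ∈ F
    · rw [Finset.insert_eq_of_mem hmem] at hFk ⊢
      exact ih hFk
    rw [Finset.card_insert_of_notMem hmem] at hFk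
    obtain ⟨N, hN, e, h0, h1⟩ := ih (by omega)
    obtain ⟨κ, hκ⟩ : ∃ κ, κ ∉ F.image e := by
      by_contra hn
      push Not at hn
      have := Finset.card_le_card (fun x _ => hn x : (Finset.univ : Finset (Fin k)) ⊆ F.image e)
      have := this.trans Finset.card_image_le
      simp at this
      omega
    have hκ' : ∀ w ∈ F, e w ≠ κ := fun w hw h => hκ (h ▸ Finset.mem_image_of_mem e hw)
    obtain ⟨N', hN', hag, hw⟩ : ∃ N' ∈ H, (∀ y : Fin m → Fin k, (∀ j, y j ≠ κ) → N' y = N y) ∧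
        (A.cyl i a ∈ (N (e ∘ δ)).sets → a ∈ (N' (Function.update (e ∘ δ) i κ)).sets) := by
      -- If the cylindrification fails at `δ`, there is no demand and the network is kept.
      by_cases hc : A.cyl i a ∈ (N (e ∘ δ)).sets
      · obtain ⟨N', hN', h2, h3⟩ := hH.witness N hN (e ∘ δ) i a hc κ fun j _ => hκ' _ (hδ j)
        exact ⟨N', hN', h2, fun _ => h3⟩
      · exact ⟨N, hN, fun _ _ => rfl, fun h => absurd h hc⟩
    set e' := Function.update e (wit i a δ) κ with he'
    have hold : ∀ ε : Fin m → Henkin A, (∀ j, ε j ∈ F) →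
        e' ∘ ε = e ∘ ε ∧ N' (e' ∘ ε) = N (e ∘ ε) := by
      intro ε hε
      have h2 : e' ∘ ε = e ∘ ε := by
        funext j
        exact Function.update_of_ne (ne_of_mem_of_not_mem (hε j) hmem) _ _
      exact ⟨h2, by rw [h2]; exact hag _ fun j => hκ' _ (hε j)⟩
    refine ⟨N', hN', e', ?_, fun i' a' δ' h2 h3 => ?_⟩
    · rwa [(hold base hF.base_mem).2]
    · rcases Finset.mem_insert.1 h2 with h4 | h4
      · cases h4
        rw [(hold δ hδ).2] at h3
        rw [Function.comp_update, (hold δ hδ).1, he', Function.update_self]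
        exact hw h3
      · have hδ' := hF.mem_of_wit_mem h4
        rw [(hold δ' hδ').2] at h3
        rw [(hold _ fun j => ?_).2]
        · exact h1 i' a' δ' h4 h3
        · by_cases hj : j = i'
          · subst hj; rwa [Function.update_self]
          · rw [Function.update_of_ne hj]; exact hδ' j

/-- If `A` has bases of all finite dimensions, then there is a network with witnesses for all
cylindrifications. -/
theorem exists_network (hm : 0 < m) (h : ∀ (k : ℕ) (hk : m ≤ k), A.HasWeakBasis hk) {a₀ : A}
    (ha₀ : a₀ ≠ ⊥) :
    ∃ N : (Fin m → Henkin A) → Uf A, IsUfNetwork A N ∧ a₀ ∈ (N base).sets ∧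
      ∀ i a δ, A.cyl i a ∈ (N δ).sets → a ∈ (N (Function.update δ i (wit i a δ))).sets := by
  classical
  have key : ∀ G : Finset (Henkin A), ∃ N : (Fin m → Henkin A) → Uf A,
      IsUfNetwork A N ∧ a₀ ∈ (N base).sets ∧ ∀ i a δ, wit i a δ ∈ G →
        A.cyl i a ∈ (N δ).sets → a ∈ (N (Function.update δ i (wit i a δ))).sets := by
    intro G
    obtain ⟨F, hF, hGF⟩ := Closed.exists_superset G
    obtain ⟨H, hH⟩ := h (max m F.card) (le_max_left _ _)
    obtain ⟨N, hN, e, h0, h1⟩ := exists_network_fin hm hH ha₀ hF (le_max_right _ _)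
    exact ⟨_, (hH.network N hN).comp e, h0, fun i a δ h2 => h1 i a δ (hGF h2)⟩
  choose N hN h0 h1 using key
  -- Above `atTop`, every witness term lies in almost all finite sets, so the limit meets every
  -- demand.
  let U : Ultrafilter (Finset (Henkin A)) := Ultrafilter.of atTop
  refine ⟨_, IsUfNetwork.lim (U := U) (N := N) (Eventually.of_forall hN),
    Eventually.of_forall h0, fun i a δ h2 => ?_⟩
  have h3 : ∀ᶠ G : Finset (Henkin A) in U, wit i a δ ∈ G := by
    refine Ultrafilter.of_le atTop ?_
    filter_upwards [eventually_ge_atTop {wit i a δ}] with G hG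
    exact hG (Finset.mem_singleton_self _)
  filter_upwards [h3, Uf.mem_lim.1 h2] with G h4 h5
  exact h1 G i a δ h4 h5

end Henkin

end Henkin

/-! ### Representability and the final assembly -/

section Representation

variable {m : ℕ} {A : CylAlg.{u} m}

/-- A network with witnesses for all cylindrifications yields a homomorphism into a full set
algebra. -/
theorem IsUfNetwork.exists_isHom_fullSetAlg {X : Type u} {N : (Fin m → X) → Uf A}
    (hN : IsUfNetwork A N)
    (hw : ∀ i a δ, A.cyl i a ∈ (N δ).sets → ∃ x, a ∈ (N (Function.update δ i x)).sets)
    {a₀ : A} {δ₀ : Fin m → X} (h₀ : a₀ ∈ (N δ₀).sets) :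
    ∃ (U : Type u) (f : A → fullSetAlg m U), IsHom f ∧ f a₀ ≠ ⊥ := by
  -- Passing to classes of interchangeable nodes turns the diagonals into true equality, and labels
  -- are well defined on classes.
  let S : Setoid X := ⟨Interchangeable N, Interchangeable.refl N, fun h => h.symm,
    fun h h' => h.trans h'⟩
  let g : (Fin m → Quotient S) → Uf A := fun s => N (Quotient.out ∘ s)
  have hg : ∀ δ : Fin m → X, g (Quotient.mk S ∘ δ) = N δ := fun δ =>
    Interchangeable.label_eq fun l => Quotient.mk_out (s := S) (δ l)
  let f : A → fullSetAlg m (Quotient S) := fun a =>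
    ({s | a ∈ (g s).sets} : Set (Fin m → Quotient S))
  refine ⟨Quotient S, f, ?_, fun h => ?_⟩
  · refine
      { map_bot := Set.eq_empty_of_forall_notMem fun s => (g s).bot_notMem
        map_top := Set.eq_univ_of_forall fun s => (g s).top_mem
        map_sup := fun x y => Set.ext fun s => (g s).sup_mem_iff x y
        map_inf := fun x y => Set.ext fun s => (g s).inf_mem_iff x y
        map_compl := fun x => Set.ext fun s => (g s).compl_mem_iff x
        map_cyl := fun i x => Set.ext fun s => ⟨fun h => ?_, ?_⟩
        map_diag := fun i j => Set.ext fun s => ?_ }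
    · obtain ⟨w, hx⟩ := hw i x (Quotient.out ∘ s) h
      refine ⟨Function.update s i (Quotient.mk S w), ?_, fun j hj => by simp [hj]⟩
      show x ∈ (g _).sets
      rw [← hg, Function.comp_update] at hx
      convert hx using 4
      funext j
      simp
    · rintro ⟨t, ht, hts⟩
      have h1 := hN.cyl (Quotient.out ∘ t) i (Quotient.out (s i)) x ht
      have hs : Function.update t i (s i) = s := by
        funext j
        by_cases hj : j = i
        · subst hj; simp
        · simp [hj, hts j hj]
      rwa [← Function.comp_update, hs] at h1
    · show A.diag i j ∈ (N (Quotient.out ∘ s)).sets ↔ s i = s j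
      rw [← hN.interchangeable_iff]
      exact Quotient.out_equiv_out (s := S)
  · have h1 : (Quotient.mk S ∘ δ₀) ∈ (show Set (Fin m → Quotient S) from f a₀) := by
      show a₀ ∈ (g _).sets
      rwa [hg]
    rw [h] at h1
    exact h1

/-- One full set algebra is used for each nonzero element, so the product of the homomorphisms has
trivial kernel. -/
theorem mem_RCA_of_hasWeakBasis (hm : 0 < m)
    (h : ∀ (k : ℕ) (hk : m ≤ k), A.HasWeakBasis hk) : A ∈ RCA m := by
  have key : ∀ a : {a : A // a ≠ ⊥}, ∃ (U : Type u) (f : A → fullSetAlg m U),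
      IsHom f ∧ f a.1 ≠ ⊥ := by
    rintro ⟨a, ha⟩
    obtain ⟨N, hN, h0, h1⟩ := Henkin.exists_network hm h ha
    exact hN.exists_isHom_fullSetAlg (fun i a δ h => ⟨_, h1 i a δ h⟩) h0
  choose U f hf hne using key
  have hhom : IsHom (B := CylAlg.prod fun a => fullSetAlg m (U a)) (fun x a => f a x) :=
    { map_bot := funext fun a => (hf a).map_bot
      map_top := funext fun a => (hf a).map_top
      map_sup := fun x y => funext fun a => (hf a).map_sup x y
      map_inf := fun x y => funext fun a => (hf a).map_inf x y
      map_compl := fun x => funext fun a => (hf a).map_compl x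
      map_cyl := fun i x => funext fun a => (hf a).map_cyl i x
      map_diag := fun i j => funext fun a => (hf a).map_diag i j }
  exact ⟨_, U, _, hhom, hhom.injective_of_ne_bot fun a ha h => hne ⟨a, ha⟩ (congrFun h _)⟩

theorem isVariety_CAB {n : ℕ} (hmn : m ≤ n) : IsVariety (CAB.{u} hmn) where
  homImage A hA B f hf surj := by
    obtain ⟨h1, h2⟩ := mem_CAB_iff.1 hA
    exact mem_CAB_of_hasBasis_canExt (h1.of_surjective hf surj)
      (h2.hasUfBasis.of_surjective h1 hf surj).hasBasis_canExt
  sub A hA B := by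
    rintro ⟨f, hf, inj⟩
    obtain ⟨h1, h2⟩ := mem_CAB_iff.1 hA
    exact mem_CAB_iff.2 ⟨h1.of_injective hf inj, h2.comap hf inj⟩
  prod I A hA :=
    mem_CAB_iff.2 ⟨IsCA.prod fun j => (mem_CAB_iff.1 (hA j)).1,
      HasWeakBasis.prod fun j => (mem_CAB_iff.1 (hA j)).2⟩

theorem hasBasis_canExt_of_mem_CAB {n : ℕ} {hmn : m ≤ n} (hA : A ∈ CAB hmn) :
    A.canExt.HasBasis hmn :=
  (mem_CAB_iff.1 hA).2.hasUfBasis.hasBasis_canExt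

theorem isCanonicalVariety_CAB {n : ℕ} (hmn : m ≤ n) : IsCanonicalVariety (CAB.{u} hmn) := by
  refine ⟨isVariety_CAB hmn, fun A hA => ?_⟩
  have hc := (mem_CAB_iff.1 hA).1.canExt
  exact mem_CAB_iff.2 ⟨hc, (hasBasis_canExt_of_mem_CAB hA).hasWeakBasis hc
    (inferInstanceAs (IsAtomic (Set (Uf A))))⟩

theorem iInter_CAB_eq_RCA (hm : 0 < m) :
    (⋂ (k : ℕ) (hk : m ≤ k), CAB.{u} hk) = RCA.{u} m := by
  ext A
  simp only [Set.mem_iInter]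
  constructor
  · exact fun h => mem_RCA_of_hasWeakBasis hm fun k hk => (mem_CAB_iff.1 (h k hk)).2
  · rintro ⟨I, U, hA⟩ k hk
    exact (isVariety_CAB hk).sub _ ((isVariety_CAB hk).prod I _ fun j =>
      mem_CAB_iff.2 ⟨IsCA.fullSetAlg m (U j), hasWeakBasis_fullSetAlg hm hk (U j)⟩) A hA

end Representation

end CylAlg

theorem mainTheorem7 (m n : ℕ) (hm : 2 < m) (hmn : m ≤ n) :
    CylAlg.IsCanonicalVariety (CylAlg.CAB.{u} hmn) ∧
    (∀ A : CylAlg.{u} m, A.IsCA → (A ∈ CylAlg.CAB hmn ↔ A.canExt.HasBasis hmn)) ∧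
    (∀ A : CylAlg.{u} m, A.IsCA → Nontrivial A →
      (A ∈ CylAlg.CAB hmn ↔ A.HasSquareRep n)) ∧
    (⋂ (k : ℕ) (hk : m ≤ k), CylAlg.CAB.{u} hk) = CylAlg.RCA.{u} m := by
  refine ⟨CylAlg.isCanonicalVariety_CAB hmn, fun A hA => ?_, fun A hA _ => ?_,
    CylAlg.iInter_CAB_eq_RCA (by omega)⟩
  · exact ⟨CylAlg.hasBasis_canExt_of_mem_CAB, CylAlg.mem_CAB_of_hasBasis_canExt hA⟩
  · refine ⟨CylAlg.hasSquareRep_of_mem_CAB (by omega), ?_⟩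
    rintro ⟨M, R, hR⟩
    exact CylAlg.mem_CAB_iff.2 ⟨hA, hR.hasWeakBasis hA (by omega) hmn⟩
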